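/- Let $k$ be a field of characteristic $0$, let $\mathrm{Sm}_k$ be the category of smooth separated $k$-schemes of finite type, $pt=\operatorname{Spec} k$, and let $Y$ be a presheaf of sets on $\mathrm{Sm}_k$. **Correspondences.** For $X\in\mathrm{Sm}_k$ and $n\ge 0$, an explicit framed correspondence of level $n$ from $X$ to $Y$ is a quadruple $(Z,W,\varphi,g)$ where $Z\subset\mathbb A^n_X$ is a closed subset (with reduced structure) finite over $X$, $W\to\mathbb A^n_X$ is an étale neighbourhood of $Z$ (étale, with $W\times_{\mathbb A^n_X}Z\to Z$ an isomorphism), $\varphi:W\to\mathbb A^n$ is a morphism whose zero set is the preimage of $Z$ in $W$, and $g\in Y(W)$. An explicit cobordism-framed correspondence of level $(n,N)$, $N\ge n$, is defined in the same way, with $\varphi:W\to\tau_{n,N}$ a morphism to the total space of the tautological rank-$n$ bundle over the Grassmannian $Gr_{n,N}$ and $Z$ the preimage of the zero section; such a $\varphi$ is an isomorphism class of pairs of an epimorphism $\mathcal O_W^N\to E$ onto a rank-$n$ vector bundle and a section $s\in\Gamma(W,E)$. Two explicit correspondences with the same $Z$ are equivalent if they agree on a common refinement of their étale neighbourhoods.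 Let $Fr_n(X,Y)$ and $Fr^{cob}_{n,N}(X,Y)$ be the sets of equivalence classes. Stabilisation in $n$ is $(Z,W,\varphi,g)\mapsto(0\times Z,\mathbb A^1\times W,(x,\varphi),g\circ \mathrm{pr}_W)$, where $x$ is the coordinate on $\mathbb A^1$; in the cobordism case $(x,\varphi)$ denotes $\mathcal O\oplus\mathcal O^N\to\mathcal O\oplus E$ with the section $(x,s)$, of level $(n+1,N+1)$. Cobordism-framed correspondences are also stabilised in $N$, extending $\mathcal O^N\to E$ by zero to $\mathcal O^{N+1}$. Let $\mathbb ZF(X,Y)$ (resp. $\mathbb ZF^{cob}(X,Y)$) be the free abelian group on the colimit of the $Fr_n(X,Y)$ (resp. $Fr^{cob}_{n,N}(X,Y)$) along the stabilisations, modulo the relations $[c_1]+[c_2]=[c_1\sqcup c_2]$ for correspondences $c_1,c_2$ of the same level with disjoint supports, where $c_1\sqcup c_2=(Z_1\sqcup Z_2,W_1\sqcup W_2,\varphi_1\sqcup\varphi_2,g)$ with $g|_{W_i}=g_i$. Both are presheaves of abelian groups in $X$. Composing $\varphi$ with the inclusion of $\mathbb A^n$ as the fibre of $\tau_{n,N}$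 over the projection $k^N\to k^n$ to the first $n$ coordinates gives a map of presheaves $\mathbb ZF(-,Y)\to\mathbb ZF^{cob}(-,Y)$. For a presheaf of abelian groups $F$ let $C_*F(X)$ be the alternating-sum complex of the simplicial abelian group $F(\Delta^\bullet_k\times X)$, and let $H^0$ denote its homology in degree $0$. For $m\ge0$ and $1\le i\le m$ let $e_i$ be the endomorphism of $\mathbb ZF(-,\mathbb G_m^{\times m})$ (resp. of $\mathbb ZF^{cob}(-,\mathbb G_m^{\times m})$) induced by $\mathbb G_m\to pt\xrightarrow{1}\mathbb G_m$ on the $i$-th factor; the image of the idempotent $\prod_i(1-e_i)$ is the direct summand $\mathbb ZF(-,\mathbb G_m^{\wedge m})$ (resp. $\mathbb ZF^{cob}(-,\mathbb G_m^{\wedge m})$). **Corollary.** For every presheaf of sets $Y$ on $\mathrm{Sm}_k$, the induced homomorphism $$H^0(C_*\mathbb ZF(pt,Y))\to H^0(C_*\mathbb ZF^{cob}(pt,Y))$$ is surjective. Moreover, for every $m\ge 0$ the induced homomorphism $$H^0(C_*\mathbb ZF(pt,\mathbb G_m^{\wedge m}))\to H^0(C_*\mathbb ZF^{cob}(pt,\mathbb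 G_m^{\wedge m}))$$ is surjective. -/

import Mathlib

universe u w

namespace CobFr

open CategoryTheory Limits Opposite TopologicalSpace AlgebraicGeometry

noncomputable section

/-- Smooth varieties over `k`: smooth separated `k`-schemes of finite type. -/
def IsSmoothVariety (k : Type u) [Field k] :
    ObjectProperty (Over (Spec (CommRingCat.of k))) := fun X =>
  Smooth X.hom ∧ IsSeparated X.hom ∧ QuasiCompact X.hom

/-- The category `Sm_k` of smooth varieties over `k` and morphisms of `k`-schemes. -/
abbrev Sm (k : Type u) [Field k] := (IsSmoothVariety k).FullSubcategory

variable {k : Type u} [Field k]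

namespace Sm

/-- The underlying scheme. -/
abbrev sch (X : Sm k) : Scheme.{u} := X.obj.left

/-- The structure morphism. -/
abbrev str (X : Sm k) : X.sch ⟶ Spec (CommRingCat.of k) := X.obj.hom

/-- The underlying morphism of schemes. -/
abbrev mor {X Y : Sm k} (f : X ⟶ Y) : X.sch ⟶ Y.sch := f.hom.left

instance (X : Sm k) : Smooth X.str := X.property.1
instance (X : Sm k) : IsSeparated X.str := X.property.2.1
instance (X : Sm k) : QuasiCompact X.str := X.property.2.2

/-- Constructor for objects. -/
def of (X : Scheme.{u}) (f : X ⟶ Spec (CommRingCat.of k)) (h₁ : Smooth f) (h₂ : IsSeparated f)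
    (h₃ : QuasiCompact f) : Sm k :=
  ⟨Over.mk f, h₁, h₂, h₃⟩

/-- Constructor for morphisms. -/
def homMk {X Y : Sm k} (f : X.sch ⟶ Y.sch) (h : f ≫ Y.str = X.str) : X ⟶ Y :=
  ObjectProperty.homMk (Over.homMk f h)

@[simp] lemma homMk_mor {X Y : Sm k} (f : X.sch ⟶ Y.sch) (h : f ≫ Y.str = X.str) :
    mor (homMk f h) = f := rfl

@[simp] lemma mor_comp {X Y Z : Sm k} (f : X ⟶ Y) (g : Y ⟶ Z) :
    mor (f ≫ g) = mor f ≫ mor g := rfl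

@[simp] lemma mor_id (X : Sm k) : mor (𝟙 X) = 𝟙 X.sch := rfl

lemma mor_str {X Y : Sm k} (f : X ⟶ Y) : mor f ≫ Y.str = X.str := Over.w f.hom

lemma hom_ext {X Y : Sm k} {f g : X ⟶ Y} (h : mor f = mor g) : f = g :=
  ObjectProperty.hom_ext _ (Over.OverMorphism.ext h)

/-- The point `Spec k`. -/
def pt (k : Type u) [Field k] : Sm k :=
  of (Spec (CommRingCat.of k)) (𝟙 _) inferInstance inferInstance inferInstance

/-- The product of smooth varieties over `k`. -/
def prod (X Y : Sm k) : Sm k :=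
  of (pullback X.str Y.str) (pullback.fst X.str Y.str ≫ X.str) inferInstance inferInstance
    inferInstance

/-- The functor `T ↦ T × X`. -/
def prodRight (X : Sm k) : Sm k ⥤ Sm k where
  obj T := prod T X
  map {T T'} f := homMk
    (pullback.lift (pullback.fst T.str X.str ≫ mor f) (pullback.snd T.str X.str)
      (by exact (Category.assoc _ _ _).trans ((congrArg _ (mor_str f)).trans pullback.condition)))
    (by
      change pullback.lift _ _ _ ≫ pullback.fst T'.str X.str ≫ T'.str = pullback.fst _ _ ≫ T.str
      refine (Category.assoc _ _ _).symm.trans ?_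
      refine (congrArg (· ≫ T'.str) (pullback.lift_fst _ _ _)).trans ?_
      exact (Category.assoc _ _ _).trans (congrArg _ (mor_str f)))
  map_id T := by
    apply hom_ext
    refine pullback.hom_ext ?_ ?_
    · exact (pullback.lift_fst _ _ _).trans
        ((Category.comp_id _).trans (Category.id_comp _).symm)
    · exact (pullback.lift_snd _ _ _).trans (Category.id_comp _).symm
  map_comp {T T' T''} f g := by
    apply hom_ext
    refine pullback.hom_ext ?_ ?_
    · refine (pullback.lift_fst _ _ _).trans ?_
      refine Eq.trans ?_ (Category.assoc _ _ _).symm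
      refine Eq.trans ?_ (congrArg _ (pullback.lift_fst _ _ _).symm)
      exact (Category.assoc _ _ _).symm.trans
        ((congrArg (· ≫ mor g) (pullback.lift_fst _ _ _).symm).trans (Category.assoc _ _ _))
    · refine (pullback.lift_snd _ _ _).trans ?_
      refine Eq.trans ?_ (Category.assoc _ _ _).symm
      refine Eq.trans ?_ (congrArg _ (pullback.lift_snd _ _ _).symm)
      exact (pullback.lift_snd _ _ _).symm

/-- Pullback of global functions along a morphism. -/
def res {X Y : Sm k} (f : X ⟶ Y) : Γ(Y.sch, ⊤) →+* Γ(X.sch, ⊤) := (mor f).appTop.hom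

lemma res_comp {X Y Z : Sm k} (f : X ⟶ Y) (g : Y ⟶ Z) (a : Γ(Z.sch, ⊤)) :
    res (f ≫ g) a = res f (res g a) := rfl

lemma res_id (X : Sm k) (a : Γ(X.sch, ⊤)) : res (𝟙 X) a = a := rfl

end Sm

/-! ### Affine spaces -/

/-- The index set of the coordinates of `𝔸ⁿ`. -/
abbrev Ix (n : ℕ) := ULift.{u} (Fin n)

instance smooth_affineSpace (n : ℕ) (S : Scheme.{u}) : Smooth (𝔸(Ix.{u} n; S) ↘ S) := by
  have h : Smooth (terminal.from
      (Spec (CommRingCat.of (MvPolynomial (Ix.{u} n) (ULift.{u} ℤ))))) := by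
    have := isIso_of_isTerminal specULiftZIsTerminal.{u} terminalIsTerminal (terminal.from _)
    rw [← terminal.comp_from (Spec.map (CommRingCat.ofHom
      (MvPolynomial.C : ULift.{u} ℤ →+* MvPolynomial (Ix.{u} n) (ULift.{u} ℤ))))]
    have h1 : Smooth (Spec.map (CommRingCat.ofHom
        (MvPolynomial.C : ULift.{u} ℤ →+* MvPolynomial (Ix.{u} n) (ULift.{u} ℤ)))) := by
      rw [HasRingHomProperty.Spec_iff (P := @Smooth), CommRingCat.hom_ofHom]
      have : (MvPolynomial.C : ULift.{u} ℤ →+* MvPolynomial (Ix.{u} n) (ULift.{u} ℤ)) =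
        algebraMap _ _ := rfl
      rw [this, RingHom.smooth_algebraMap]
      have h2 : Algebra.Smooth (ULift.{u} ℤ) (MvPolynomial (Ix.{u} n) (ULift.{u} ℤ)) :=
        ⟨inferInstance, inferInstance⟩
      exact h2
    infer_instance
  exact inferInstanceAs (Smooth (pullback.fst (terminal.from S) (terminal.from
      (Spec (CommRingCat.of (MvPolynomial (Ix.{u} n) (ULift.{u} ℤ)))))))

/-- Affine space `𝔸ⁿ_X`, as a smooth variety over `k`. -/
def aff (n : ℕ) (X : Sm k) : Sm k :=
  Sm.of 𝔸(Ix.{u} n; X.sch) (𝔸(Ix.{u} n; X.sch) ↘ X.sch ≫ X.str)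
    inferInstance inferInstance inferInstance

/-- The projection `𝔸ⁿ_X ⟶ X`. -/
def affProj (n : ℕ) (X : Sm k) : aff n X ⟶ X := Sm.homMk (𝔸(Ix.{u} n; X.sch) ↘ X.sch) rfl

/-- The `i`-th coordinate function on `𝔸ⁿ_X`. -/
def affCoord (n : ℕ) (X : Sm k) (i : Fin n) : Γ((aff n X).sch, ⊤) :=
  AffineSpace.coord X.sch (ULift.up i)

/-- The morphism `T ⟶ 𝔸ⁿ_X` over `X` with the given coordinates. -/
def affLift {n : ℕ} {T X : Sm k} (f : T ⟶ X) (x : Fin n → Γ(T.sch, ⊤)) : T ⟶ aff n X :=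
  Sm.homMk (AffineSpace.homOfVector (Sm.mor f) fun i => x i.down) (by
    change _ ≫ 𝔸(Ix.{u} n; X.sch) ↘ X.sch ≫ X.str = _
    rw [AffineSpace.homOfVector_over_assoc, Sm.mor_str])

lemma affLift_proj {n : ℕ} {T X : Sm k} (f : T ⟶ X) (x : Fin n → Γ(T.sch, ⊤)) :
    affLift f x ≫ affProj n X = f :=
  Sm.hom_ext (AffineSpace.homOfVector_over _ _)

lemma affLift_coord {n : ℕ} {T X : Sm k} (f : T ⟶ X) (x : Fin n → Γ(T.sch, ⊤)) (i : Fin n) :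
    Sm.res (affLift f x) (affCoord n X i) = x i :=
  AffineSpace.homOfVector_appTop_coord _ _ _

lemma aff_hom_ext {n : ℕ} {T X : Sm k} {f g : T ⟶ aff n X}
    (h : f ≫ affProj n X = g ≫ affProj n X)
    (h' : ∀ i, Sm.res f (affCoord n X i) = Sm.res g (affCoord n X i)) :
    f = g :=
  Sm.hom_ext (AffineSpace.hom_ext (congrArg Sm.mor h) fun i => h' i.down)

/-- The morphism `𝔸ⁿ_X' ⟶ 𝔸ⁿ_X` induced by `X' ⟶ X`. -/
def affMap (n : ℕ) {X' X : Sm k} (f : X' ⟶ X) : aff n X' ⟶ aff n X :=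
  affLift (affProj n X' ≫ f) (affCoord n X')

/-- The projection `𝔸¹⁺ⁿ_X ⟶ 𝔸ⁿ_X` forgetting the first coordinate. -/
def affDrop (n : ℕ) (X : Sm k) : aff (n + 1) X ⟶ aff n X :=
  affLift (affProj (n + 1) X) fun i => affCoord (n + 1) X i.succ

/-- The embedding `𝔸ⁿ_X ⟶ 𝔸¹⁺ⁿ_X` which is zero on the first coordinate. -/
def affZero (n : ℕ) (X : Sm k) : aff n X ⟶ aff (n + 1) X :=
  affLift (affProj n X) (Fin.cons 0 (affCoord n X))

lemma affMap_proj (n : ℕ) {X' X : Sm k} (f : X' ⟶ X) :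
    affMap n f ≫ affProj n X = affProj n X' ≫ f := affLift_proj _ _

lemma affMap_coord (n : ℕ) {X' X : Sm k} (f : X' ⟶ X) (i : Fin n) :
    Sm.res (affMap n f) (affCoord n X i) = affCoord n X' i := affLift_coord _ _ _

lemma affDrop_proj (n : ℕ) (X : Sm k) : affDrop n X ≫ affProj n X = affProj (n + 1) X :=
  affLift_proj _ _

lemma affDrop_coord (n : ℕ) (X : Sm k) (i : Fin n) :
    Sm.res (affDrop n X) (affCoord n X i) = affCoord (n + 1) X i.succ := affLift_coord _ _ _

lemma affZero_proj (n : ℕ) (X : Sm k) : affZero n X ≫ affProj (n + 1) X = affProj n X :=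
  affLift_proj _ _

lemma affZero_coord_zero (n : ℕ) (X : Sm k) :
    Sm.res (affZero n X) (affCoord (n + 1) X 0) = 0 := affLift_coord _ _ _

lemma affZero_coord_succ (n : ℕ) (X : Sm k) (i : Fin n) :
    Sm.res (affZero n X) (affCoord (n + 1) X i.succ) = affCoord n X i := affLift_coord _ _ _

lemma affZero_drop (n : ℕ) (X : Sm k) : affZero n X ≫ affDrop n X = 𝟙 _ := by
  apply aff_hom_ext
  · rw [Category.assoc, affDrop_proj, affZero_proj, Category.id_comp]
  · intro i
    rw [Sm.res_comp, affDrop_coord, affZero_coord_succ, Sm.res_id]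

lemma affMap_id (n : ℕ) (X : Sm k) : affMap n (𝟙 X) = 𝟙 _ := by
  apply aff_hom_ext
  · rw [affMap_proj, Category.comp_id, Category.id_comp]
  · intro i
    rw [affMap_coord, Sm.res_id]

lemma affMap_comp (n : ℕ) {X'' X' X : Sm k} (f : X'' ⟶ X') (g : X' ⟶ X) :
    affMap n (f ≫ g) = affMap n f ≫ affMap n g := by
  apply aff_hom_ext
  · rw [affMap_proj, Category.assoc, affMap_proj, ← Category.assoc, ← Category.assoc, affMap_proj]
  · intro i
    rw [affMap_coord, Sm.res_comp, affMap_coord, affMap_coord]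

lemma affMap_drop (n : ℕ) {X' X : Sm k} (f : X' ⟶ X) :
    affMap (n + 1) f ≫ affDrop n X = affDrop n X' ≫ affMap n f := by
  apply aff_hom_ext
  · rw [Category.assoc, affDrop_proj, affMap_proj, Category.assoc, affMap_proj, ← Category.assoc,
      affDrop_proj]
  · intro i
    rw [Sm.res_comp, affDrop_coord, affMap_coord, Sm.res_comp, affMap_coord, affDrop_coord]

instance isSeparated_mor {X Y : Sm k} (f : X ⟶ Y) : IsSeparated (Sm.mor f) := by
  have : IsSeparated (Sm.mor f ≫ Y.str) := by rw [Sm.mor_str]; infer_instance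
  exact IsSeparated.of_comp _ Y.str

instance quasiCompact_mor {X Y : Sm k} (f : X ⟶ Y) : QuasiCompact (Sm.mor f) := by
  have : QuasiCompact (Sm.mor f ≫ Y.str) := by rw [Sm.mor_str]; infer_instance
  exact QuasiCompact.of_comp _ Y.str

instance (n : ℕ) (X : Sm k) : IsClosedImmersion (Sm.mor (affZero n X)) := by
  have h : Sm.mor (affZero n X) ≫ Sm.mor (affDrop n X) = 𝟙 _ := congrArg Sm.mor (affZero_drop n X)
  have : IsClosedImmersion (Sm.mor (affZero n X) ≫ Sm.mor (affDrop n X)) := by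
    rw [h]; infer_instance
  exact IsClosedImmersion.of_comp _ (Sm.mor (affDrop n X))

/-! ### The standard cosimplicial variety -/

/-- The coordinate ring `k[x₀, …, xₙ] / (x₀ + ⋯ + xₙ - 1)` of the algebraic `n`-simplex. -/
abbrev SimplexRing (k : Type u) [Field k] (n : ℕ) : Type u :=
  MvPolynomial (Fin (n + 1)) k ⧸ Ideal.span {(∑ i, MvPolynomial.X i - 1 :
    MvPolynomial (Fin (n + 1)) k)}

namespace SimplexRing

/-- The barycentric coordinates. -/
def bary (k : Type u) [Field k] {n : ℕ} (i : Fin (n + 1)) : SimplexRing k n :=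
  Ideal.Quotient.mk _ (MvPolynomial.X i)

lemma sum_bary (k : Type u) [Field k] (n : ℕ) : ∑ i, bary k i = (1 : SimplexRing k n) := by
  have h : Ideal.Quotient.mk (Ideal.span {(∑ i, MvPolynomial.X i - 1 :
      MvPolynomial (Fin (n + 1)) k)}) (∑ i, MvPolynomial.X i - 1) = 0 :=
    Ideal.Quotient.eq_zero_iff_mem.mpr (Ideal.subset_span rfl)
  rw [map_sub, map_one, sub_eq_zero, map_sum] at h
  exact h

/-- The algebra homomorphism out of `SimplexRing k n` with prescribed values at the
barycentric coordinates. -/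
def lift {n : ℕ} {B : Type u} [CommRing B] [Algebra k B] (b : Fin (n + 1) → B)
    (hb : ∑ i, b i = 1) : SimplexRing k n →ₐ[k] B :=
  Ideal.Quotient.liftₐ _ (MvPolynomial.aeval b) (by
    intro a ha
    have : Ideal.span {(∑ i, MvPolynomial.X i - 1 : MvPolynomial (Fin (n + 1)) k)} ≤
        RingHom.ker (MvPolynomial.aeval b : MvPolynomial (Fin (n + 1)) k →ₐ[k] B) := by
      rw [Ideal.span_singleton_le_iff_mem, RingHom.mem_ker]
      simp [hb]
    exact this ha)

lemma lift_bary {n : ℕ} {B : Type u} [CommRing B] [Algebra k B] (b : Fin (n + 1) → B)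
    (hb : ∑ i, b i = 1) (i : Fin (n + 1)) : lift (k := k) b hb (bary k i) = b i := by
  change MvPolynomial.aeval b (MvPolynomial.X i) = b i
  simp

lemma hom_ext {n : ℕ} {B : Type u} [CommRing B] [Algebra k B] {f g : SimplexRing k n →ₐ[k] B}
    (h : ∀ i, f (bary k i) = g (bary k i)) : f = g := by
  apply Ideal.Quotient.algHom_ext
  exact MvPolynomial.algHom_ext h

/-- The homomorphism `xⱼ ↦ ∑_{θ i = j} xᵢ`. -/
def map {m n : ℕ} (θ : Fin (m + 1) → Fin (n + 1)) : SimplexRing k n →ₐ[k] SimplexRing k m :=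
  lift (fun j => ∑ i with θ i = j, bary k i) (by
    rw [Finset.sum_fiberwise, sum_bary])

lemma map_bary {m n : ℕ} (θ : Fin (m + 1) → Fin (n + 1)) (j : Fin (n + 1)) :
    map θ (bary k j) = ∑ i with θ i = j, bary k i := lift_bary _ _ _

lemma map_id (n : ℕ) : map (k := k) (id : Fin (n + 1) → Fin (n + 1)) = AlgHom.id k _ := by
  apply hom_ext
  intro i
  simp [map_bary, Finset.sum_filter]

lemma map_comp {l m n : ℕ} (η : Fin (l + 1) → Fin (m + 1)) (θ : Fin (m + 1) → Fin (n + 1)) :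
    map (k := k) (θ ∘ η) = (map η).comp (map θ) := by
  apply hom_ext
  intro j
  rw [map_bary, AlgHom.comp_apply, map_bary, map_sum]
  simp only [map_bary, Finset.sum_filter, Function.comp_apply]
  have h : ∀ i : Fin (m + 1), (if θ i = j then ∑ a, (if η a = i then bary k a else 0) else 0) =
      ∑ a, if i = η a then (if θ i = j then bary k a else 0) else 0 := by
    intro i
    split_ifs
    · simp only [eq_comm]
    · simp
  rw [Finset.sum_congr rfl fun i _ => h i, Finset.sum_comm]
  simp

instance smooth (n : ℕ) : Algebra.Smooth k (SimplexRing k n) := by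
  let f : MvPolynomial (Fin (n + 1)) k →ₐ[k] SimplexRing k n := Ideal.Quotient.mkₐ k _
  let s : SimplexRing k n →ₐ[k] MvPolynomial (Fin (n + 1)) k :=
    lift (Fin.cons (1 - ∑ i : Fin n, MvPolynomial.X i.succ) fun i => MvPolynomial.X i.succ)
      (by simp [Fin.sum_univ_succ])
  have hs : f.comp s = AlgHom.id k _ := by
    apply hom_ext
    intro i
    have hf : ∀ i, f (MvPolynomial.X i) = bary k i := fun _ => rfl
    rw [AlgHom.comp_apply, lift_bary]
    refine Fin.cases ?_ (fun i => ?_) i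
    · simp only [Fin.cons_zero, map_sub, map_one, map_sum, hf, AlgHom.id_apply]
      have h := sum_bary k n
      rw [Fin.sum_univ_succ] at h
      rw [← h, add_sub_cancel_right]
    · simp [hf]
  refine ⟨Algebra.FormallySmooth.of_split f
    ((Ideal.Quotient.mkₐ k _).comp s) ?_, ?_⟩
  · rw [← hs]
    ext
    rfl
  · exact Algebra.FinitePresentation.quotient
      ⟨{∑ i, MvPolynomial.X i - 1}, by rw [Finset.coe_singleton]⟩

end SimplexRing

/-- The algebraic `n`-simplex `Δⁿ_k`. -/
def simplex (k : Type u) [Field k] (n : ℕ) : Sm k :=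
  Sm.of (Spec (CommRingCat.of (SimplexRing k n)))
    (Spec.map (CommRingCat.ofHom (algebraMap k (SimplexRing k n))))
    (by
      rw [HasRingHomProperty.Spec_iff (P := @Smooth), CommRingCat.hom_ofHom,
        RingHom.smooth_algebraMap]
      infer_instance)
    inferInstance inferInstance

/-- The standard cosimplicial variety `Δ^•_k`. -/
def simplexFunctor (k : Type u) [Field k] : SimplexCategory ⥤ Sm k where
  obj n := simplex k n.len
  map {m n} θ := Sm.homMk
    (Spec.map (CommRingCat.ofHom (SimplexRing.map (k := k) θ.toOrderHom).toRingHom)) (by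
      refine (Spec.map_comp _ _).symm.trans ?_
      change Spec.map (CommRingCat.ofHom _ ≫ CommRingCat.ofHom _) = Spec.map _
      rw [← CommRingCat.ofHom_comp]
      congr 2
      exact (SimplexRing.map (k := k) θ.toOrderHom).comp_algebraMap)
  map_id n := by
    apply Sm.hom_ext
    refine Eq.trans ?_ (Spec.map_id _)
    change Spec.map (CommRingCat.ofHom (SimplexRing.map (k := k)
      (id : Fin (n.len + 1) → Fin (n.len + 1))).toRingHom) = _
    rw [SimplexRing.map_id]
    rfl
  map_comp {l m n} η θ := by
    apply Sm.hom_ext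
    refine Eq.trans ?_ (Spec.map_comp _ _)
    change Spec.map (CommRingCat.ofHom (SimplexRing.map (k := k)
      (θ.toOrderHom ∘ η.toOrderHom)).toRingHom) = _
    rw [SimplexRing.map_comp]
    rfl

/-! ### Étale neighbourhoods -/

/-- The closed immersion of a closed subset with its reduced subscheme structure. -/
abbrev redι {A : Scheme.{u}} (Z : Closeds A) :
    (Scheme.IdealSheafData.vanishingIdeal Z).subscheme ⟶ A :=
  (Scheme.IdealSheafData.vanishingIdeal Z).subschemeι

/-- `e : W ⟶ A` is an étale neighbourhood of the closed subset `Z` of `A`: it is étale, and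
`W ×_A Z ⟶ Z` is an isomorphism. -/
structure IsEtaleNbhd {W A : Scheme.{u}} (e : W ⟶ A) (Z : Closeds A) : Prop where
  etale : Etale e
  isIso : IsIso (pullback.snd e (redι Z))

/-- The closed subset `Z` of `A` is finite over `X`. -/
def IsFiniteOver {A X : Scheme.{u}} (q : A ⟶ X) (Z : Closeds A) : Prop :=
  IsFinite (redι Z ≫ q)

lemma exists_redMap {A B : Scheme.{u}} (h : B ⟶ A) {Z' : Closeds B} {Z : Closeds A}
    (hZ : ∀ z ∈ Z', h z ∈ Z) : ∃ r, r ≫ redι Z = redι Z' ≫ h := by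
  refine ⟨Scheme.IdealSheafData.subschemeMap _ _ h ?_,
    Scheme.IdealSheafData.subschemeMap_subschemeι _ _ _ _⟩
  rw [Scheme.IdealSheafData.map_vanishingIdeal]
  apply Scheme.IdealSheafData.vanishingIdeal_antimono
  rw [Closeds.closure_le]
  rintro _ ⟨z, hz, rfl⟩
  exact hZ z hz

lemma IsEtaleNbhd.of_isPullback {W A B W' : Scheme.{u}} {e : W ⟶ A} {h : B ⟶ A} {p : W' ⟶ W}
    {e' : W' ⟶ B} (sq : IsPullback p e' e h) {Z : Closeds A} {Z' : Closeds B}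
    (he : IsEtaleNbhd e Z) (hZ : ∀ z ∈ Z', h z ∈ Z) : IsEtaleNbhd e' Z' := by
  obtain ⟨r, hr⟩ := exists_redMap h hZ
  have he1 := he.etale
  have he2 := he.isIso
  refine ⟨?_, ?_⟩
  · have h1 : e' = sq.isoPullback.hom ≫ pullback.snd e h := sq.isoPullback_hom_snd.symm
    rw [h1]
    infer_instance
  · have s1 : IsPullback (pullback.fst e' (redι Z') ≫ p) (pullback.snd e' (redι Z')) e
        (redι Z' ≫ h) :=
      ((IsPullback.of_hasPullback e' (redι Z')).flip.paste_vert sq.flip).flip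
    rw [← hr] at s1
    have s2 := IsPullback.of_bot' s1.flip (IsPullback.of_hasPullback e (redι Z)).flip
    exact (MorphismProperty.isomorphisms Scheme.{u}).of_isPullback s2.flip he2

lemma IsFiniteOver.of_isPullback {A X B X' : Scheme.{u}} {q : A ⟶ X} {f : X' ⟶ X} {h : B ⟶ A}
    {q' : B ⟶ X'} (sq : IsPullback h q' q f) {Z : Closeds A} {Z' : Closeds B}
    (hf : IsFiniteOver q Z) (hZ : ∀ z ∈ Z', h z ∈ Z) : IsFiniteOver q' Z' := by
  obtain ⟨r, hr⟩ := exists_redMap h hZ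
  have hf' : IsFinite (redι Z ≫ q) := hf
  have s1 : IsPullback (pullback.fst (redι Z) h) (pullback.snd (redι Z) h ≫ q') (redι Z ≫ q) f :=
    (IsPullback.of_hasPullback (redι Z) h).paste_vert sq
  have h1 : IsFinite (pullback.snd (redι Z) h ≫ q') := by
    rw [← s1.isoPullback_hom_snd]
    infer_instance
  have h2 : pullback.lift r (redι Z') hr ≫ pullback.snd (redι Z) h = redι Z' :=
    pullback.lift_snd _ _ _
  have h3 : IsClosedImmersion (pullback.lift r (redι Z') hr ≫ pullback.snd (redι Z) h) := by
    rw [h2]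
    infer_instance
  have h4 : IsClosedImmersion (pullback.lift r (redι Z') hr) :=
    IsClosedImmersion.of_comp_isClosedImmersion _ (pullback.snd (redι Z) h)
  unfold IsFiniteOver
  rw [← h2, Category.assoc]
  infer_instance

lemma IsFiniteOver.of_image {A B X : Scheme.{u}} {i : A ⟶ B} [IsClosedImmersion i] {q : B ⟶ X}
    {Z : Closeds A} {Z' : Closeds B} (hZ : (Z' : Set B) = i '' Z)
    (hf : IsFiniteOver (i ≫ q) Z) : IsFiniteOver q Z' := by
  obtain ⟨r, hr⟩ := exists_redMap i (Z' := Z) (Z := Z') (by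
    intro z hz
    rw [← SetLike.mem_coe, hZ]
    exact ⟨z, hz, rfl⟩)
  have : IsIso r := by
    refine IsClosedImmersion.isIso_of_ker_eq _ _ r hr ?_
    rw [Scheme.Hom.ker_comp, Scheme.IdealSheafData.ker_subschemeι,
      Scheme.IdealSheafData.ker_subschemeι, Scheme.IdealSheafData.map_vanishingIdeal]
    congr 1
    apply SetLike.coe_injective
    rw [Closeds.coe_closure, ← hZ, Z'.isClosed.closure_eq]
  unfold IsFiniteOver at hf ⊢
  rw [← Category.assoc, ← hr, Category.assoc] at hf
  rw [← IsIso.inv_hom_id_assoc r (redι Z' ≫ q)]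
  infer_instance

lemma affMap_isPullback (n : ℕ) {X' X : Sm k} (f : X' ⟶ X) :
    IsPullback (Sm.mor (affMap n f)) (Sm.mor (affProj n X')) (Sm.mor (affProj n X))
      (Sm.mor f) :=
  AffineSpace.isPullback_map _

/-- The pullback of an étale morphism `e : W ⟶ A` of smooth varieties along `h : B ⟶ A`. -/
def etPull {W A B : Sm k} (e : W ⟶ A) (he : Etale (Sm.mor e)) (h : B ⟶ A) : Sm k :=
  Sm.of (pullback (Sm.mor e) (Sm.mor h)) (pullback.snd (Sm.mor e) (Sm.mor h) ≫ B.str)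
    inferInstance inferInstance inferInstance

namespace etPull

variable {W A B : Sm k} (e : W ⟶ A) (he : Etale (Sm.mor e)) (h : B ⟶ A)

/-- The projection to `W`. -/
def fst : etPull e he h ⟶ W :=
  Sm.homMk (pullback.fst (Sm.mor e) (Sm.mor h)) (by
    change _ = pullback.snd (Sm.mor e) (Sm.mor h) ≫ B.str
    rw [← Sm.mor_str h, ← Sm.mor_str e]
    exact (Category.assoc _ _ _).symm.trans
      ((congrArg (· ≫ A.str) pullback.condition).trans (Category.assoc _ _ _)))

/-- The projection to `B`. -/
def snd : etPull e he h ⟶ B := Sm.homMk (pullback.snd (Sm.mor e) (Sm.mor h)) rfl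

lemma condition : fst e he h ≫ e = snd e he h ≫ h := Sm.hom_ext pullback.condition

lemma isPullback : IsPullback (Sm.mor (fst e he h)) (Sm.mor (snd e he h)) (Sm.mor e)
    (Sm.mor h) := IsPullback.of_hasPullback _ _

variable {e h} in
/-- The universal property. -/
def lift {T : Sm k} (a : T ⟶ W) (b : T ⟶ B) (hab : a ≫ e = b ≫ h) : T ⟶ etPull e he h :=
  Sm.homMk (pullback.lift (Sm.mor a) (Sm.mor b) (congrArg Sm.mor hab)) (by
    refine (Category.assoc _ _ _).symm.trans ?_
    exact (congrArg (· ≫ B.str) (pullback.lift_snd _ _ _)).trans (Sm.mor_str b))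

variable {e h} in
lemma lift_fst {T : Sm k} (a : T ⟶ W) (b : T ⟶ B) (hab : a ≫ e = b ≫ h) :
    lift he a b hab ≫ fst e he h = a := Sm.hom_ext (pullback.lift_fst _ _ _)

variable {e h} in
lemma lift_snd {T : Sm k} (a : T ⟶ W) (b : T ⟶ B) (hab : a ≫ e = b ≫ h) :
    lift he a b hab ≫ snd e he h = b := Sm.hom_ext (pullback.lift_snd _ _ _)

end etPull

/-! ### Targets of framings

A framing is a map from an étale neighbourhood to the total space of a vector bundle; its support
is the preimage of the zero section. `FramingTarget` records such a total space through its functor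
of points, together with the zero section. The two instances are `𝔸ⁿ` over a point and the
tautological bundle over the Grassmannian. -/

/-- A functor of points on schemes together with a zero locus: `IsZero t w` says that the map
`t : W ⟶ F` sends the point `w` of `W` to the zero locus. -/
structure FramingTarget where
  /-- the maps `W ⟶ F` -/
  F : Scheme.{u}ᵒᵖ ⥤ Type u
  /-- the preimage of the zero locus -/
  IsZero {W : Scheme.{u}} (t : F.obj (op W)) (w : W) : Prop
  isZero_map {W W' : Scheme.{u}} (f : W' ⟶ W) (t : F.obj (op W)) (w : W') :
    IsZero (F.map f.op t) w ↔ IsZero t (f w)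

/-- A map of framing targets, under which the zero locus is the preimage of the zero locus. -/
structure FramingTarget.Hom (T T' : FramingTarget.{u}) where
  /-- the map on points -/
  app {W : Scheme.{u}} (t : T.F.obj (op W)) : T'.F.obj (op W)
  natural {W W' : Scheme.{u}} (f : W' ⟶ W) (t : T.F.obj (op W)) :
    T'.F.map f.op (app t) = app (T.F.map f.op t)
  isZero_app {W : Scheme.{u}} (t : T.F.obj (op W)) (w : W) :
    T'.IsZero (app t) w ↔ T.IsZero t w

/-- A map `𝔸¹ × T ⟶ T'` of framing targets, under which the zero locus is the preimage of the zero
locus. -/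
structure FramingTarget.SuspHom (T T' : FramingTarget.{u}) where
  /-- the map on points -/
  app {W : Scheme.{u}} (x : Γ(W, ⊤)) (t : T.F.obj (op W)) : T'.F.obj (op W)
  natural {W W' : Scheme.{u}} (f : W' ⟶ W) (x : Γ(W, ⊤)) (t : T.F.obj (op W)) :
    T'.F.map f.op (app x t) = app (f.appTop x) (T.F.map f.op t)
  isZero_app {W : Scheme.{u}} (x : Γ(W, ⊤)) (t : T.F.obj (op W)) (w : W) :
    T'.IsZero (app x t) w ↔ w ∉ W.basicOpen x ∧ T.IsZero t w

lemma notMem_basicOpen_appTop {W W' : Scheme.{u}} (f : W' ⟶ W) (x : Γ(W, ⊤)) (w : W') :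
    w ∉ W'.basicOpen (f.appTop x) ↔ f w ∉ W.basicOpen x := by
  rw [← Scheme.preimage_basicOpen_top]
  rfl

/-- The affine space `𝔸ⁿ`, with the origin: a map `W ⟶ 𝔸ⁿ` is an `n`-tuple of functions. -/
def affTarget (n : ℕ) : FramingTarget.{u} where
  F :=
    { obj W := Fin n → Γ(W.unop, ⊤)
      map f := TypeCat.ofHom fun φ i => f.unop.appTop (φ i)
      map_id W := by ext; simp
      map_comp f g := by ext; rfl }
  IsZero {W} φ w := ∀ i, w ∉ W.basicOpen (φ i)
  isZero_map f φ w := forall_congr' fun i => notMem_basicOpen_appTop f (φ i) w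

/-- The map `𝔸¹ × 𝔸ⁿ ⟶ 𝔸¹⁺ⁿ`. -/
def affSusp (n : ℕ) : (affTarget.{u} n).SuspHom (affTarget.{u} (n + 1)) where
  app {W} x φ := (Fin.cons x φ : Fin (n + 1) → Γ(W, ⊤))
  natural {W W'} f x φ := by
    funext i
    refine Fin.cases ?_ (fun i => ?_) i <;> rfl
  isZero_app {W} x φ w := by
    change (∀ i : Fin (n + 1), w ∉ W.basicOpen ((Fin.cons x φ : Fin (n + 1) → Γ(W, ⊤)) i)) ↔ _
    rw [Fin.forall_fin_succ]
    rfl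

/-! ### The tautological bundle over the Grassmannian -/

/-- A trivialised point of the tautological bundle over a ring `R`: an epimorphism `A : Rᴺ ⟶ Rⁿ`
together with an element `v` of `Rⁿ`. -/
@[ext] structure TautDatum (R : Type u) [CommRing R] (n N : ℕ) where
  /-- the matrix of the epimorphism -/
  A : Matrix (Fin n) (Fin N) R
  /-- the section -/
  v : Fin n → R
  surj : Function.Surjective A.mulVec

namespace TautDatum

open Matrix

variable {R S : Type u} [CommRing R] [CommRing S] {n N : ℕ}

/-- Base change. -/
def map (f : R →+* S) (d : TautDatum R n N) : TautDatum S n N where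
  A := d.A.map f
  v := f ∘ d.v
  surj := by
    obtain ⟨B, hB⟩ := mulVec_surjective_iff_exists_right_inverse.mp d.surj
    refine mulVec_surjective_iff_exists_right_inverse.mpr ⟨B.map f, ?_⟩
    rw [← Matrix.map_mul, hB, Matrix.map_one f (map_zero f) (map_one f)]

/-- Two trivialised points are identified if they differ by a change of basis `M` of `Rⁿ`, that
is, if the quotients `Rᴺ ⟶ Rⁿ` with their sections are isomorphic. -/
instance setoid (R : Type u) [CommRing R] (n N : ℕ) : Setoid (TautDatum R n N) where
  r d d' := ∃ M : (Matrix (Fin n) (Fin n) R)ˣ, d'.A = M.val * d.A ∧ d'.v = M.val *ᵥ d.v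
  iseqv :=
    { refl := fun d => ⟨1, by simp, by simp⟩
      symm := by
        rintro d d' ⟨M, hA, hv⟩
        refine ⟨M⁻¹, ?_, ?_⟩
        · rw [hA, ← Matrix.mul_assoc, Units.inv_mul, Matrix.one_mul]
        · rw [hv, Matrix.mulVec_mulVec, Units.inv_mul, Matrix.one_mulVec]
      trans := by
        rintro d d' d'' ⟨M, hA, hv⟩ ⟨M', hA', hv'⟩
        refine ⟨M' * M, ?_, ?_⟩
        · rw [hA', hA, Units.val_mul, Matrix.mul_assoc]
        · rw [hv', hv, Units.val_mul, Matrix.mulVec_mulVec] }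

lemma equiv_iff {d d' : TautDatum R n N} : d ≈ d' ↔
    ∃ M : (Matrix (Fin n) (Fin n) R)ˣ, d'.A = M.val * d.A ∧ d'.v = M.val *ᵥ d.v := Iff.rfl

lemma map_equiv (f : R →+* S) {d d' : TautDatum R n N} (h : d ≈ d') : d.map f ≈ d'.map f := by
  obtain ⟨M, hA, hv⟩ := h
  refine ⟨Units.map (RingHom.mapMatrix f).toMonoidHom M, ?_, ?_⟩
  · change d'.A.map f = M.val.map f * d.A.map f
    rw [hA, Matrix.map_mul]
  · change f ∘ d'.v = M.val.map f *ᵥ (f ∘ d.v)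
    rw [hv]
    funext i
    exact RingHom.map_mulVec f _ _ i

/-- The stabilisation `Rᴺ ⊕ R ⟶ Rⁿ`, zero on the last summand. -/
def inc (d : TautDatum R n N) : TautDatum R n (N + 1) where
  A := Matrix.of fun i => Fin.snoc (d.A i) 0
  v := d.v
  surj := by
    intro y
    obtain ⟨x, hx⟩ := d.surj y
    refine ⟨Fin.snoc x 0, ?_⟩
    rw [← hx]
    funext i
    simp [Matrix.mulVec, dotProduct, Fin.sum_univ_castSucc]

/-- The block matrix with blocks `1` and `A`. -/
def oneBlock {n N : ℕ} (A : Matrix (Fin n) (Fin N) R) : Matrix (Fin (n + 1)) (Fin (N + 1)) R :=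
  Matrix.of (Fin.cons (Fin.cons 1 0) fun i => Fin.cons 0 (A i))

lemma oneBlock_mulVec {n N : ℕ} (A : Matrix (Fin n) (Fin N) R) (x : R) (v : Fin N → R) :
    oneBlock A *ᵥ (Fin.cons x v) = Fin.cons x (A *ᵥ v) := by
  funext i
  refine Fin.cases ?_ (fun i => ?_) i <;>
    simp [oneBlock, Matrix.mulVec, dotProduct, Fin.sum_univ_succ]

lemma oneBlock_mul {m n N : ℕ} (A : Matrix (Fin m) (Fin n) R) (B : Matrix (Fin n) (Fin N) R) :
    oneBlock (A * B) = oneBlock A * oneBlock B := by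
  ext i j
  refine Fin.cases ?_ (fun i => ?_) i <;> refine Fin.cases ?_ (fun j => ?_) j <;>
    simp [oneBlock, Matrix.mul_apply, Fin.sum_univ_succ]

lemma oneBlock_one (n : ℕ) : oneBlock (1 : Matrix (Fin n) (Fin n) R) = 1 := by
  ext i j
  refine Fin.cases ?_ (fun i => ?_) i <;> refine Fin.cases ?_ (fun j => ?_) j <;>
    simp [oneBlock, Matrix.one_apply, Fin.succ_ne_zero, eq_comm]

lemma oneBlock_map (f : R →+* S) {n N : ℕ} (A : Matrix (Fin n) (Fin N) R) :
    (oneBlock A).map f = oneBlock (A.map f) := by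
  ext i j
  refine Fin.cases ?_ (fun i => ?_) i <;> refine Fin.cases ?_ (fun j => ?_) j <;>
    simp [oneBlock]

/-- The direct sum `R ⊕ Rᴺ ⟶ R ⊕ Rⁿ` with the identity of `R`, with the section `(x, v)`. -/
def susp (x : R) (d : TautDatum R n N) : TautDatum R (n + 1) (N + 1) where
  A := oneBlock d.A
  v := Fin.cons x d.v
  surj := by
    intro y
    obtain ⟨z, hz⟩ := d.surj (Fin.tail y)
    exact ⟨Fin.cons (y 0) z, by rw [oneBlock_mulVec, hz, Fin.cons_self_tail]⟩

/-- Renaming the number of coordinates. -/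
def cast {N' : ℕ} (h : N' = N) (d : TautDatum R n N) : TautDatum R n N' where
  A := d.A.submatrix id (Fin.cast h)
  v := d.v
  surj := by subst h; exact d.surj

lemma map_inc (f : R →+* S) (d : TautDatum R n N) : d.inc.map f = (d.map f).inc := by
  ext i j
  · refine Fin.lastCases ?_ (fun j => ?_) j <;> simp [map, inc]
  · rfl

lemma map_susp (f : R →+* S) (x : R) (d : TautDatum R n N) :
    (d.susp x).map f = (d.map f).susp (f x) := by
  ext i j
  · exact congrFun (congrFun (oneBlock_map f d.A) i) j
  · refine Fin.cases ?_ (fun i => ?_) i <;> rfl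

lemma map_cast (f : R →+* S) {N' : ℕ} (h : N' = N) (d : TautDatum R n N) :
    (d.cast h).map f = (d.map f).cast h := rfl

lemma inc_equiv {d d' : TautDatum R n N} (h : d ≈ d') : d.inc ≈ d'.inc := by
  obtain ⟨M, hA, hv⟩ := h
  refine ⟨M, ?_, hv⟩
  ext i j
  refine Fin.lastCases ?_ (fun j => ?_) j <;> simp [inc, hA, Matrix.mul_apply]

lemma susp_equiv (x : R) {d d' : TautDatum R n N} (h : d ≈ d') : d.susp x ≈ d'.susp x := by
  obtain ⟨M, hA, hv⟩ := h
  refine ⟨⟨oneBlock M.val, oneBlock M⁻¹.val, ?_, ?_⟩, ?_, ?_⟩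
  · rw [← oneBlock_mul, Units.mul_inv, oneBlock_one]
  · rw [← oneBlock_mul, Units.inv_mul, oneBlock_one]
  · change oneBlock d'.A = oneBlock M.val * oneBlock d.A
    rw [hA, oneBlock_mul]
  · change Fin.cons x d'.v = oneBlock M.val *ᵥ Fin.cons x d.v
    rw [hv, oneBlock_mulVec]

lemma cast_equiv {N' : ℕ} (h : N' = N) {d d' : TautDatum R n N} (hd : d ≈ d') :
    d.cast h ≈ d'.cast h := by
  subst h
  exact hd

/-- The projection `Rᴺ ⟶ Rⁿ` to the first `n` coordinates, with the section `v`. -/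
def proj (h : n ≤ N) (v : Fin n → R) : TautDatum R n N where
  A := Matrix.of fun i j => if (i : ℕ) = j then 1 else 0
  v := v
  surj := by
    refine mulVec_surjective_iff_exists_right_inverse.mpr
      ⟨Matrix.of fun j i => if (i : ℕ) = j then 1 else 0, ?_⟩
    ext i i'
    rw [Matrix.mul_apply, Finset.sum_eq_single (Fin.castLE h i)]
    · simp [Matrix.one_apply, Fin.ext_iff, eq_comm]
    · intro j _ hj
      have : ¬ (i : ℕ) = j := fun e => hj (Fin.ext e.symm)
      simp [this]
    · simp

lemma map_proj (f : R →+* S) (h : n ≤ N) (v : Fin n → R) :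
    (proj h v).map f = proj h (f ∘ v) := by
  ext i j
  · simp only [map, proj, Matrix.map_apply, Matrix.of_apply]
    split_ifs <;> simp
  · rfl

end TautDatum

/-- Isomorphism classes of epimorphisms `Rᴺ ⟶ E` onto a free module `E` of rank `n`, with an
element of `E`. -/
def TautClass (R : Type u) [CommRing R] (n N : ℕ) : Type u := Quotient (TautDatum.setoid R n N)

namespace TautClass

variable {R S : Type u} [CommRing R] [CommRing S] {n N : ℕ}

/-- The class of a datum. -/
def mk (d : TautDatum R n N) : TautClass R n N := Quotient.mk _ d

/-- Base change. -/
def map (f : R →+* S) : TautClass R n N → TautClass S n N :=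
  Quotient.map (TautDatum.map f) fun _ _ h => TautDatum.map_equiv f h

lemma map_mk (f : R →+* S) (d : TautDatum R n N) : map f (mk d) = mk (d.map f) := rfl

lemma map_id (t : TautClass R n N) : map (RingHom.id R) t = t := by
  induction t using Quotient.inductionOn with | _ d => rfl

lemma map_map {T : Type u} [CommRing T] (f : R →+* S) (g : S →+* T) (t : TautClass R n N) :
    map g (map f t) = map (g.comp f) t := by
  induction t using Quotient.inductionOn with | _ d => rfl

/-- The stabilisation in `N`. -/
def inc : TautClass R n N → TautClass R n (N + 1) :=
  Quotient.map TautDatum.inc fun _ _ h => TautDatum.inc_equiv h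

/-- The stabilisation in `n`. -/
def susp (x : R) : TautClass R n N → TautClass R (n + 1) (N + 1) :=
  Quotient.map (TautDatum.susp x) fun _ _ h => TautDatum.susp_equiv x h

/-- Renaming the number of coordinates. -/
def cast {N' : ℕ} (h : N' = N) : TautClass R n N → TautClass R n N' :=
  Quotient.map (TautDatum.cast h) fun _ _ hd => TautDatum.cast_equiv h hd

/-- Over a local ring: the section vanishes at the closed point. -/
def IsZero [IsLocalRing R] : TautClass R n N → Prop :=
  Quotient.lift (fun d => ∀ i, d.v i ∈ IsLocalRing.maximalIdeal R) (by
    have key : ∀ d d' : TautDatum R n N, d ≈ d' →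
        (∀ i, d.v i ∈ IsLocalRing.maximalIdeal R) → ∀ i, d'.v i ∈ IsLocalRing.maximalIdeal R := by
      rintro d d' ⟨M, -, hv⟩ h i
      rw [hv, Matrix.mulVec, dotProduct]
      exact Ideal.sum_mem _ fun j _ => Ideal.mul_mem_left _ _ (h j)
    exact fun d d' h => propext ⟨key d d' h, key d' d (Setoid.symm h)⟩)

lemma isZero_map [IsLocalRing R] [IsLocalRing S] (f : R →+* S) [IsLocalHom f]
    (t : TautClass R n N) : (map f t).IsZero ↔ t.IsZero := by
  induction t using Quotient.inductionOn with
  | _ d =>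
    refine forall_congr' fun i => ?_
    change f (d.v i) ∈ _ ↔ _
    rw [IsLocalRing.mem_maximalIdeal, IsLocalRing.mem_maximalIdeal, mem_nonunits_iff,
      mem_nonunits_iff, isUnit_map_iff]

lemma isZero_inc [IsLocalRing R] (t : TautClass R n N) : t.inc.IsZero ↔ t.IsZero := by
  induction t using Quotient.inductionOn with | _ d => exact Iff.rfl

lemma isZero_cast [IsLocalRing R] {N' : ℕ} (h : N' = N) (t : TautClass R n N) :
    (t.cast h).IsZero ↔ t.IsZero := by
  induction t using Quotient.inductionOn with | _ d => exact Iff.rfl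

lemma isZero_susp [IsLocalRing R] (x : R) (t : TautClass R n N) :
    (t.susp x).IsZero ↔ x ∈ IsLocalRing.maximalIdeal R ∧ t.IsZero := by
  induction t using Quotient.inductionOn with
  | _ d =>
    change (∀ i : Fin (n + 1), (Fin.cons x d.v : Fin (n + 1) → R) i ∈ _) ↔ _
    rw [Fin.forall_fin_succ]
    rfl

end TautClass

/-- A map `W ⟶ τ_{n,N}` to the total space of the tautological bundle over the Grassmannian, that
is, an isomorphism class of pairs of an epimorphism `𝒪_W^N ⟶ E` onto a locally free sheaf of rank
`n` and a global section `s` of `E`. Such a pair is given by its germs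
`𝒪_{W,w}^N ⟶ E_w ∋ s_w`, where `E_w` is free of rank `n`; a family of germs comes from a pair if and
only if locally it is the family of germs of a matrix and a vector of functions, i.e. of a pair
with a trivialised `E`. (Equivalently, `τ_{n,N}` is the quotient of the scheme of pairs `(A, v)` by
the free action of `GL_n`, which is locally trivial in the Zariski topology.) -/
@[ext] structure TautMap (W : Scheme.{u}) (n N : ℕ) where
  /-- the germs -/
  germ (w : W) : TautClass (W.presheaf.stalk w) n N
  locally_trivial (w : W) : ∃ (U : W.Opens) (_ : w ∈ U) (d : TautDatum Γ(W, U) n N),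
    ∀ (x : W) (hx : x ∈ U), germ x = TautClass.mk (d.map (W.presheaf.germ U x hx).hom)

namespace TautMap

variable {n N : ℕ}

/-- The composition with a morphism `W' ⟶ W`. -/
def pull {W W' : Scheme.{u}} (f : W' ⟶ W) (t : TautMap W n N) : TautMap W' n N where
  germ w := TautClass.map (f.stalkMap w).hom (t.germ (f w))
  locally_trivial w := by
    obtain ⟨U, hU, d, hd⟩ := t.locally_trivial (f w)
    refine ⟨f ⁻¹ᵁ U, hU, d.map (f.app U).hom, fun x hx => ?_⟩
    rw [hd (f x) hx, TautClass.map_mk]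
    change TautClass.mk (d.map ((W.presheaf.germ U (f x) hx) ≫ f.stalkMap x).hom) =
      TautClass.mk (d.map ((f.app U) ≫ W'.presheaf.germ (f ⁻¹ᵁ U) x hx).hom)
    exact congrArg (fun a => TautClass.mk (d.map (CommRingCat.Hom.hom a)))
      (Scheme.Hom.germ_stalkMap f U x hx)

/-- Operations on germs that are defined on data and compatible with base change. -/
def ofLocal {W : Scheme.{u}} {n' N' : ℕ} (t : TautMap W n N)
    (G : ∀ w : W, TautClass (W.presheaf.stalk w) n N → TautClass (W.presheaf.stalk w) n' N')
    (D : ∀ U : W.Opens, TautDatum Γ(W, U) n N → TautDatum Γ(W, U) n' N')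
    (h : ∀ (U : W.Opens) (d : TautDatum Γ(W, U) n N) (w : W) (hw : w ∈ U),
      G w (TautClass.mk (d.map (W.presheaf.germ U w hw).hom)) =
        TautClass.mk ((D U d).map (W.presheaf.germ U w hw).hom)) : TautMap W n' N' where
  germ w := G w (t.germ w)
  locally_trivial w := by
    obtain ⟨U, hU, d, hd⟩ := t.locally_trivial w
    exact ⟨U, hU, D U d, fun x hx => by rw [hd x hx, h]⟩

/-- The composition with the map `τ_{n,N} ⟶ τ_{n,N+1}`. -/
def inc {W : Scheme.{u}} (t : TautMap W n N) : TautMap W n (N + 1) :=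
  t.ofLocal (fun _ => TautClass.inc) (fun _ => TautDatum.inc) fun U d w hw => by
    rw [TautDatum.map_inc]
    rfl

/-- Renaming the number of coordinates. -/
def cast {W : Scheme.{u}} {N' : ℕ} (h : N' = N) (t : TautMap W n N) : TautMap W n N' :=
  t.ofLocal (fun _ => TautClass.cast h) (fun _ => TautDatum.cast h) fun U d w hw => by
    rw [TautDatum.map_cast]
    rfl

/-- The composition with the map `𝔸¹ × τ_{n,N} ⟶ τ_{1+n,1+N}`. -/
def susp {W : Scheme.{u}} (x : Γ(W, ⊤)) (t : TautMap W n N) : TautMap W (n + 1) (N + 1) :=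
  t.ofLocal (fun w => TautClass.susp (W.presheaf.germ ⊤ w trivial x))
    (fun U => TautDatum.susp (W.presheaf.map (homOfLE le_top).op x)) fun U d w hw => by
    rw [TautDatum.map_susp]
    have h : (W.presheaf.germ U w hw).hom (W.presheaf.map (homOfLE le_top).op x) =
      W.presheaf.germ ⊤ w trivial x := W.presheaf.germ_res_apply _ _ _ _
    rw [h]
    rfl

/-- The map `W ⟶ τ_{n,N}` given by a matrix and a vector of functions. -/
def ofDatum {W : Scheme.{u}} (d : TautDatum Γ(W, ⊤) n N) : TautMap W n N where
  germ w := TautClass.mk (d.map (W.presheaf.germ ⊤ w trivial).hom)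
  locally_trivial _ := ⟨⊤, trivial, d, fun _ _ => rfl⟩

end TautMap

/-- The total space `τ_{n,N}` of the tautological bundle over the Grassmannian, with its zero
section. -/
def tautTarget (n N : ℕ) : FramingTarget.{u} where
  F :=
    { obj W := TautMap W.unop n N
      map f := TypeCat.ofHom fun t => t.pull f.unop
      map_id W := by
        ext t w
        change TautClass.map (Scheme.Hom.stalkMap (𝟙 W.unop) w).hom (t.germ w) = t.germ w
        rw [Scheme.Hom.stalkMap_id]
        exact TautClass.map_id _
      map_comp {W W' W''} f g := by
        ext t w
        change TautClass.map (Scheme.Hom.stalkMap (g.unop ≫ f.unop) w).hom _ = _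
        rw [Scheme.Hom.stalkMap_comp]
        exact (TautClass.map_map _ _ _).symm }
  IsZero t w := (t.germ w).IsZero
  isZero_map f t w := TautClass.isZero_map (f.stalkMap w).hom (t.germ (f w))

lemma notMem_basicOpen_iff {W : Scheme.{u}} (x : Γ(W, ⊤)) (w : W) :
    w ∉ W.basicOpen x ↔
      W.presheaf.germ ⊤ w trivial x ∈ IsLocalRing.maximalIdeal (W.presheaf.stalk w) := by
  rw [Scheme.mem_basicOpen W x w trivial, IsLocalRing.mem_maximalIdeal, mem_nonunits_iff]

/-- The map `τ_{n,n+N} ⟶ τ_{n,n+N+1}` extending an epimorphism by zero on the last coordinate. -/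
def tautInc (n N : ℕ) : (tautTarget.{u} n (n + N)).Hom (tautTarget.{u} n (n + (N + 1))) where
  app t := TautMap.inc t
  natural {W W'} f t := by
    apply TautMap.ext
    funext w
    change TautClass.map (f.stalkMap w).hom (t.germ (f w)).inc =
      (TautClass.map (f.stalkMap w).hom (t.germ (f w))).inc
    induction t.germ (f w) using Quotient.inductionOn with
    | _ d => exact congrArg TautClass.mk (TautDatum.map_inc _ d)
  isZero_app t w := TautClass.isZero_inc _

/-- The map `𝔸¹ × τ_{n,n+N} ⟶ τ_{1+n,1+n+N}`, the direct sum with the identity epimorphism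
`𝒪 ⟶ 𝒪` and with the section of `𝒪` given by the coordinate of `𝔸¹`. -/
def tautSusp (n N : ℕ) :
    (tautTarget.{u} n (n + N)).SuspHom (tautTarget.{u} (n + 1) (n + 1 + N)) where
  app x t := (TautMap.susp x t).cast (by omega)
  natural {W W'} f x t := by
    apply TautMap.ext
    funext w
    change TautClass.map (f.stalkMap w).hom
        (((t.germ (f w)).susp (W.presheaf.germ ⊤ (f w) trivial x)).cast _) =
      ((TautClass.map (f.stalkMap w).hom (t.germ (f w))).susp
        (W'.presheaf.germ ⊤ w trivial (f.appTop x))).cast _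
    have h : W'.presheaf.germ ⊤ w trivial (f.appTop x) =
        (f.stalkMap w).hom (W.presheaf.germ ⊤ (f w) trivial x) :=
      (Scheme.Hom.germ_stalkMap_apply f ⊤ w trivial x).symm
    rw [h]
    induction t.germ (f w) using Quotient.inductionOn with
    | _ d =>
      refine congrArg TautClass.mk ?_
      rw [TautDatum.map_cast, TautDatum.map_susp]
  isZero_app {W} x t w := by
    rw [notMem_basicOpen_iff]
    exact (TautClass.isZero_cast _ _).trans (TautClass.isZero_susp _ _)

/-- The embedding `i_{n,n+N} : 𝔸ⁿ ⟶ τ_{n,n+N}` of the fibre of the tautological bundle over the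
point of the Grassmannian given by the projection to the first `n` coordinates. -/
def tautFibre (n N : ℕ) : (affTarget.{u} n).Hom (tautTarget.{u} n (n + N)) where
  app φ := TautMap.ofDatum (TautDatum.proj (Nat.le_add_right n N) φ)
  natural {W W'} f φ := by
    apply TautMap.ext
    funext w
    change TautClass.mk (((TautDatum.proj _ φ).map (W.presheaf.germ ⊤ (f w) trivial).hom).map
      (f.stalkMap w).hom) = TautClass.mk ((TautDatum.proj _ fun i => f.appTop (φ i)).map
        (W'.presheaf.germ ⊤ w trivial).hom)
    refine congrArg TautClass.mk (((congrArg _ (TautDatum.map_proj _ _ _)).trans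
      (TautDatum.map_proj _ _ _)).trans (Eq.trans ?_ (TautDatum.map_proj _ _ _).symm))
    refine congrArg (TautDatum.proj _) ?_
    funext i
    exact Scheme.Hom.germ_stalkMap_apply f ⊤ w trivial (φ i)
  isZero_app {W} φ w := by
    change (∀ i, W.presheaf.germ ⊤ w trivial (φ i) ∈ _) ↔ ∀ i, w ∉ W.basicOpen (φ i)
    exact forall_congr' fun i => (notMem_basicOpen_iff (φ i) w).symm

/-! ### Correspondences -/

/-- An explicit correspondence `(Z, W, φ, g)` of level `n` from `X` to the presheaf `Y`, with a
framing `φ` in `T`: a closed subset `Z` of `𝔸ⁿ_X` finite over `X`, an étale neighbourhood `W` of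
`Z` in `𝔸ⁿ_X`, a map `φ : W ⟶ T` such that `Z` (as a subset of `W`) is the preimage of the zero
locus, and a section `g` of `Y` over `W`. -/
structure Corr (T : FramingTarget.{u}) (n : ℕ) (X : Sm k) (Y : (Sm k)ᵒᵖ ⥤ Type w) where
  /-- the support -/
  Z : Closeds (aff n X).sch
  finite : IsFiniteOver (Sm.mor (affProj n X)) Z
  /-- the étale neighbourhood -/
  W : Sm k
  /-- its morphism to `𝔸ⁿ_X` -/
  e : W ⟶ aff n X
  nbhd : IsEtaleNbhd (Sm.mor e) Z
  /-- the framing -/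
  φ : T.F.obj (op W.sch)
  zero (w : W.sch) : T.IsZero φ w ↔ Sm.mor e w ∈ Z
  /-- the morphism to `Y` -/
  g : Y.obj (op W)

namespace Corr

variable {T T' : FramingTarget.{u}} {n : ℕ} {X X' : Sm k} {Y Y' : (Sm k)ᵒᵖ ⥤ Type w}

/-- `c'` is obtained from `c` by refining the étale neighbourhood. -/
def Refines (c' c : Corr T n X Y) : Prop :=
  c'.Z = c.Z ∧ ∃ i : c'.W ⟶ c.W, i ≫ c.e = c'.e ∧ T.F.map (Sm.mor i).op c.φ = c'.φ ∧
    Y.map i.op c.g = c'.g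

/-- Explicit correspondences are equivalent if they have the same support and agree on a common
refinement of their étale neighbourhoods. -/
def Equivalent (c c' : Corr T n X Y) : Prop := ∃ c'' : Corr T n X Y, c''.Refines c ∧ c''.Refines c'

lemma Refines.refl (c : Corr T n X Y) : c.Refines c :=
  ⟨rfl, 𝟙 _, Category.id_comp _, by
    change T.F.map (𝟙 (op c.W.sch)) c.φ = c.φ
    simp, by simp⟩

/-- `c` is the disjoint sum of `c₁` and `c₂`: the supports are disjoint and
`(Z, W, φ, g) = (Z₁ ⨿ Z₂, W₁ ⨿ W₂, φ₁ ⨿ φ₂, g₁ ⨿ g₂)`. -/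
structure IsDisjointSum (c c₁ c₂ : Corr T n X Y) : Prop where
  disjoint : Disjoint (c₁.Z : Set (aff n X).sch) c₂.Z
  union : (c.Z : Set (aff n X).sch) = (c₁.Z : Set (aff n X).sch) ∪ c₂.Z
  coprod : ∃ (j₁ : c₁.W ⟶ c.W) (j₂ : c₂.W ⟶ c.W),
    IsOpenImmersion (Sm.mor j₁) ∧ IsOpenImmersion (Sm.mor j₂) ∧
    IsCompl (Set.range (Sm.mor j₁)) (Set.range (Sm.mor j₂)) ∧
    j₁ ≫ c.e = c₁.e ∧ j₂ ≫ c.e = c₂.e ∧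
    T.F.map (Sm.mor j₁).op c.φ = c₁.φ ∧ T.F.map (Sm.mor j₂).op c.φ = c₂.φ ∧
    Y.map j₁.op c.g = c₁.g ∧ Y.map j₂.op c.g = c₂.g

lemma F_map_comp (T : FramingTarget.{u}) {A B C : Sm k} (f : A ⟶ B) (g : B ⟶ C)
    (t : T.F.obj (op C.sch)) :
    T.F.map (Sm.mor (f ≫ g)).op t = T.F.map (Sm.mor f).op (T.F.map (Sm.mor g).op t) := by
  change T.F.map ((Sm.mor g).op ≫ (Sm.mor f).op) t = _
  simp

lemma F_map_congr (T : FramingTarget.{u}) {A B C D : Sm k} {f : A ⟶ B} {g : B ⟶ D} {f' : A ⟶ C}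
    {g' : C ⟶ D} (h : f ≫ g = f' ≫ g') (t : T.F.obj (op D.sch)) :
    T.F.map (Sm.mor f).op (T.F.map (Sm.mor g).op t) =
      T.F.map (Sm.mor f').op (T.F.map (Sm.mor g').op t) := by
  rw [← F_map_comp, ← F_map_comp, h]

lemma Y_map_comp (Y : (Sm k)ᵒᵖ ⥤ Type w) {A B C : Sm k} (f : A ⟶ B) (g : B ⟶ C)
    (t : Y.obj (op C)) : Y.map (f ≫ g).op t = Y.map f.op (Y.map g.op t) := by
  simp

lemma Y_map_congr (Y : (Sm k)ᵒᵖ ⥤ Type w) {A B C D : Sm k} {f : A ⟶ B} {g : B ⟶ D} {f' : A ⟶ C}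
    {g' : C ⟶ D} (h : f ≫ g = f' ≫ g') (t : Y.obj (op D)) :
    Y.map f.op (Y.map g.op t) = Y.map f'.op (Y.map g'.op t) := by
  rw [← Y_map_comp, ← Y_map_comp, h]

/-! #### Base change -/

/-- The base change of a correspondence along a morphism `f : X' ⟶ X`. -/
def baseChange (f : X' ⟶ X) (c : Corr T n X Y) : Corr T n X' Y where
  Z := c.Z.preimage (Sm.mor (affMap n f)).continuous
  finite := c.finite.of_isPullback (affMap_isPullback n f) fun _ h => h
  W := etPull c.e c.nbhd.etale (affMap n f)
  e := etPull.snd _ _ _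
  nbhd := c.nbhd.of_isPullback (etPull.isPullback _ _ _) fun _ h => h
  φ := T.F.map (Sm.mor (etPull.fst c.e c.nbhd.etale (affMap n f))).op c.φ
  zero w := by
    rw [T.isZero_map, c.zero, ← Scheme.Hom.comp_apply, ← Sm.mor_comp, etPull.condition]
    rfl
  g := Y.map (etPull.fst _ _ _).op c.g

/-- The projection to the original étale neighbourhood. -/
def bcFst (f : X' ⟶ X) (c : Corr T n X Y) : (c.baseChange f).W ⟶ c.W := etPull.fst c.e c.nbhd.etale (affMap n f)

lemma bc_condition (f : X' ⟶ X) (c : Corr T n X Y) :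
    c.bcFst f ≫ c.e = (c.baseChange f).e ≫ affMap n f := etPull.condition c.e c.nbhd.etale (affMap n f)

lemma bc_isPullback (f : X' ⟶ X) (c : Corr T n X Y) :
    IsPullback (Sm.mor (c.bcFst f)) (Sm.mor (c.baseChange f).e) (Sm.mor c.e)
      (Sm.mor (affMap n f)) := etPull.isPullback c.e c.nbhd.etale (affMap n f)

lemma bc_φ (f : X' ⟶ X) (c : Corr T n X Y) :
    (c.baseChange f).φ = T.F.map (Sm.mor (c.bcFst f)).op c.φ := rfl

lemma bc_g (f : X' ⟶ X) (c : Corr T n X Y) :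
    (c.baseChange f).g = Y.map (c.bcFst f).op c.g := rfl

lemma mem_bc_Z (f : X' ⟶ X) (c : Corr T n X Y) (p : (aff n X').sch) :
    p ∈ (c.baseChange f).Z ↔ Sm.mor (affMap n f) p ∈ c.Z := Iff.rfl

lemma exists_bcLift (f : X' ⟶ X) (c : Corr T n X Y) {B : Sm k} (a : B ⟶ c.W) (b : B ⟶ aff n X')
    (h : a ≫ c.e = b ≫ affMap n f) :
    ∃ i : B ⟶ (c.baseChange f).W, i ≫ c.bcFst f = a ∧ i ≫ (c.baseChange f).e = b :=
  ⟨etPull.lift c.nbhd.etale a b h, etPull.lift_fst c.nbhd.etale a b h, etPull.lift_snd c.nbhd.etale a b h⟩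

lemma Refines.baseChange (f : X' ⟶ X) {c' c : Corr T n X Y} (h : c'.Refines c) :
    (c'.baseChange f).Refines (c.baseChange f) := by
  obtain ⟨hZ, i, he, hφ, hg⟩ := h
  obtain ⟨i', h1, h2⟩ := exists_bcLift f c (c'.bcFst f ≫ i) (c'.baseChange f).e (by
    rw [Category.assoc, he, bc_condition])
  refine ⟨?_, i', h2, ?_, ?_⟩
  · ext p
    change p ∈ (c'.baseChange f).Z ↔ p ∈ (c.baseChange f).Z
    rw [mem_bc_Z, mem_bc_Z, hZ]
  · rw [bc_φ, bc_φ, ← hφ]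
    exact F_map_congr T h1 _
  · rw [bc_g, bc_g, ← hg]
    exact Y_map_congr Y h1 _

lemma baseChange_id_refines (c : Corr T n X Y) : (c.baseChange (𝟙 X)).Refines c := by
  refine ⟨?_, c.bcFst _, ?_, rfl, rfl⟩
  · ext p
    change p ∈ (c.baseChange (𝟙 X)).Z ↔ p ∈ c.Z
    rw [mem_bc_Z, affMap_id]
    rfl
  · rw [bc_condition, affMap_id, Category.comp_id]

lemma baseChange_comp_refines {X'' : Sm k} (f : X'' ⟶ X') (g : X' ⟶ X) (c : Corr T n X Y) :
    ((c.baseChange g).baseChange f).Refines (c.baseChange (f ≫ g)) := by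
  obtain ⟨i, h1, h2⟩ := exists_bcLift (f ≫ g) c ((c.baseChange g).bcFst f ≫ c.bcFst g)
    ((c.baseChange g).baseChange f).e (by
      rw [Category.assoc, bc_condition, affMap_comp, ← Category.assoc, bc_condition,
        Category.assoc])
  refine ⟨?_, i, h2, ?_, ?_⟩
  · ext p
    change p ∈ ((c.baseChange g).baseChange f).Z ↔ p ∈ (c.baseChange (f ≫ g)).Z
    rw [mem_bc_Z, mem_bc_Z, mem_bc_Z, affMap_comp]
    rfl
  · rw [bc_φ, bc_φ, bc_φ]
    exact F_map_congr T h1 _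
  · rw [bc_g, bc_g, bc_g]
    exact Y_map_congr Y h1 _

lemma exists_bc_coprod (f : X' ⟶ X) (c' c : Corr T n X Y) (j : c'.W ⟶ c.W) (e' : j ≫ c.e = c'.e)
    (o : IsOpenImmersion (Sm.mor j)) :
    ∃ j' : (c'.baseChange f).W ⟶ (c.baseChange f).W,
      IsOpenImmersion (Sm.mor j') ∧
      Set.range (Sm.mor j') = Sm.mor (c.bcFst f) ⁻¹' Set.range (Sm.mor j) ∧
      j' ≫ c.bcFst f = c'.bcFst f ≫ j ∧ j' ≫ (c.baseChange f).e = (c'.baseChange f).e := by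
  obtain ⟨j', h1, h2⟩ := exists_bcLift f c (c'.bcFst f ≫ j) (c'.baseChange f).e (by
    rw [Category.assoc, e', bc_condition])
  have s : IsPullback (Sm.mor (c'.bcFst f)) (Sm.mor j') (Sm.mor j) (Sm.mor (c.bcFst f)) := by
    have s1 := c'.bc_isPullback f
    have s2 := c.bc_isPullback f
    rw [← h2, ← e', Sm.mor_comp, Sm.mor_comp] at s1
    exact IsPullback.of_bot s1 (congrArg Sm.mor h1).symm s2
  refine ⟨j', ?_, ?_, h1, h2⟩
  · rw [← s.isoPullback_hom_snd]
    infer_instance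
  · have h3 : Set.range (Sm.mor j') =
        Set.range (pullback.snd (Sm.mor j) (Sm.mor (c.bcFst f))) := by
      rw [← s.isoPullback_hom_snd]
      exact s.isoPullback.hom.surjective.range_comp _
    rw [h3, Scheme.Pullback.range_snd]

lemma IsDisjointSum.baseChange (f : X' ⟶ X) {c c₁ c₂ : Corr T n X Y} (h : c.IsDisjointSum c₁ c₂) :
    (c.baseChange f).IsDisjointSum (c₁.baseChange f) (c₂.baseChange f) := by
  obtain ⟨hd, hu, j₁, j₂, o₁, o₂, hc, e₁, e₂, φ₁, φ₂, g₁, g₂⟩ := h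
  obtain ⟨j₁', s₁, r₁, p₁, q₁⟩ := exists_bc_coprod f c₁ c j₁ e₁ o₁
  obtain ⟨j₂', s₂, r₂, p₂, q₂⟩ := exists_bc_coprod f c₂ c j₂ e₂ o₂
  refine ⟨hd.preimage _, ?_, j₁', j₂', s₁, s₂, ?_, q₁, q₂, ?_, ?_, ?_, ?_⟩
  · change Sm.mor (affMap n f) ⁻¹' c.Z = _
    rw [hu]
    rfl
  · rw [r₁, r₂, ← hc.compl_eq, Set.preimage_compl]
    exact isCompl_compl
  · rw [bc_φ, bc_φ, ← φ₁]
    exact F_map_congr T p₁ _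
  · rw [bc_φ, bc_φ, ← φ₂]
    exact F_map_congr T p₂ _
  · rw [bc_g, bc_g, ← g₁]
    exact Y_map_congr Y p₁ _
  · rw [bc_g, bc_g, ← g₂]
    exact Y_map_congr Y p₂ _

/-! #### Change of the framing target and of the presheaf -/

/-- The composition of the framing with a map of framing targets. -/
def mapTarget (η : T.Hom T') (c : Corr T n X Y) : Corr T' n X Y where
  Z := c.Z
  finite := c.finite
  W := c.W
  e := c.e
  nbhd := c.nbhd
  φ := η.app c.φ
  zero w := (η.isZero_app c.φ w).trans (c.zero w)
  g := c.g

lemma Refines.mapTarget (η : T.Hom T') {c' c : Corr T n X Y} (h : c'.Refines c) :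
    (c'.mapTarget η).Refines (c.mapTarget η) := by
  obtain ⟨hZ, i, he, hφ, hg⟩ := h
  exact ⟨hZ, i, he, (η.natural _ _).trans (congrArg _ hφ), hg⟩

lemma mapTarget_baseChange (η : T.Hom T') (f : X' ⟶ X) (c : Corr T n X Y) :
    (c.mapTarget η).baseChange f = (c.baseChange f).mapTarget η := by
  simp only [mapTarget, baseChange]
  congr 1
  exact η.natural _ _

lemma IsDisjointSum.mapTarget (η : T.Hom T') {c c₁ c₂ : Corr T n X Y}
    (h : c.IsDisjointSum c₁ c₂) :
    (c.mapTarget η).IsDisjointSum (c₁.mapTarget η) (c₂.mapTarget η) := by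
  obtain ⟨hd, hu, j₁, j₂, o₁, o₂, hc, e₁, e₂, φ₁, φ₂, g₁, g₂⟩ := h
  exact ⟨hd, hu, j₁, j₂, o₁, o₂, hc, e₁, e₂, (η.natural _ _).trans (congrArg _ φ₁),
    (η.natural _ _).trans (congrArg _ φ₂), g₁, g₂⟩

/-- The composition of a correspondence with a map of presheaves. -/
def mapPresheaf (α : Y ⟶ Y') (c : Corr T n X Y) : Corr T n X Y' where
  Z := c.Z
  finite := c.finite
  W := c.W
  e := c.e
  nbhd := c.nbhd
  φ := c.φ
  zero := c.zero
  g := α.app (op c.W) c.g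

lemma nat_apply (α : Y ⟶ Y') {A B : Sm k} (f : A ⟶ B) (y : Y.obj (op B)) :
    Y'.map f.op (α.app (op B) y) = α.app (op A) (Y.map f.op y) :=
  (NatTrans.naturality_apply α f.op y).symm

lemma Refines.mapPresheaf (α : Y ⟶ Y') {c' c : Corr T n X Y} (h : c'.Refines c) :
    (c'.mapPresheaf α).Refines (c.mapPresheaf α) := by
  obtain ⟨hZ, i, he, hφ, hg⟩ := h
  exact ⟨hZ, i, he, hφ, (nat_apply α _ _).trans (congrArg _ hg)⟩

lemma mapPresheaf_baseChange (α : Y ⟶ Y') (f : X' ⟶ X) (c : Corr T n X Y) :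
    (c.mapPresheaf α).baseChange f = (c.baseChange f).mapPresheaf α := by
  simp only [mapPresheaf, baseChange]
  congr 1
  exact nat_apply α _ _

lemma IsDisjointSum.mapPresheaf (α : Y ⟶ Y') {c c₁ c₂ : Corr T n X Y}
    (h : c.IsDisjointSum c₁ c₂) :
    (c.mapPresheaf α).IsDisjointSum (c₁.mapPresheaf α) (c₂.mapPresheaf α) := by
  obtain ⟨hd, hu, j₁, j₂, o₁, o₂, hc, e₁, e₂, φ₁, φ₂, g₁, g₂⟩ := h
  exact ⟨hd, hu, j₁, j₂, o₁, o₂, hc, e₁, e₂, φ₁, φ₂, (nat_apply α _ _).trans (congrArg _ g₁),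
    (nat_apply α _ _).trans (congrArg _ g₂)⟩

/-! #### Suspension -/

/-- The image of a closed subset under `𝔸ⁿ_X ⟶ 𝔸¹⁺ⁿ_X`. -/
def suspSupport (Z : Closeds (aff n X).sch) : Closeds (aff (n + 1) X).sch :=
  ⟨Sm.mor (affZero n X) '' Z,
    (Sm.mor (affZero n X)).isClosedEmbedding.isClosedMap _ Z.isClosed⟩

lemma mem_suspSupport (Z : Closeds (aff n X).sch) (p : (aff (n + 1) X).sch) :
    p ∈ suspSupport Z ↔
      p ∉ (aff (n + 1) X).sch.basicOpen (affCoord (n + 1) X 0) ∧ Sm.mor (affDrop n X) p ∈ Z := by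
  constructor
  · rintro ⟨z, hz, rfl⟩
    constructor
    · rw [← notMem_basicOpen_appTop]
      have h : (Sm.mor (affZero n X)).appTop (affCoord (n + 1) X 0) = 0 :=
        affZero_coord_zero n X
      rw [h, Scheme.basicOpen_zero]
      exact fun h => h
    · rw [← Scheme.Hom.comp_apply, ← Sm.mor_comp, affZero_drop]
      exact hz
  · rintro ⟨h0, hZ⟩
    refine ⟨Sm.mor (affDrop n X) p, hZ, ?_⟩
    have key : (aff (n + 1) X).sch.fromSpecResidueField p ≫
        Sm.mor (affDrop n X) ≫ Sm.mor (affZero n X) =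
        (aff (n + 1) X).sch.fromSpecResidueField p := by
      refine AffineSpace.hom_ext ?_ ?_
      · have h : Sm.mor (affDrop n X) ≫ Sm.mor (affZero n X) ≫ Sm.mor (affProj (n + 1) X) =
            Sm.mor (affProj (n + 1) X) := by
          rw [← Sm.mor_comp, affZero_proj, ← Sm.mor_comp, affDrop_proj]
        refine (Category.assoc _ _ _).trans (congrArg _ ?_)
        exact (Category.assoc _ _ _).trans h
      · rintro ⟨i⟩
        change ((aff (n + 1) X).sch.fromSpecResidueField p).appTop
          (Sm.res (affDrop n X) (Sm.res (affZero n X) (affCoord (n + 1) X i))) =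
          ((aff (n + 1) X).sch.fromSpecResidueField p).appTop (affCoord (n + 1) X i)
        refine Fin.cases ?_ (fun i => ?_) i
        · rw [affZero_coord_zero, map_zero, map_zero]
          symm
          rw [← basicOpen_eq_bot_iff, ← Scheme.preimage_basicOpen_top]
          ext q
          constructor
          · intro hq
            change (aff (n + 1) X).sch.fromSpecResidueField p q ∈
              (aff (n + 1) X).sch.basicOpen (affCoord (n + 1) X 0) at hq
            rw [Scheme.fromSpecResidueField_apply] at hq
            exact (h0 hq).elim
          · exact fun h => h.elim
        · rw [affZero_coord_succ, affDrop_coord]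
    obtain ⟨q⟩ : Nonempty (Spec ((aff (n + 1) X).sch.residueField p)) := inferInstance
    have h := congrArg (fun m : Spec ((aff (n + 1) X).sch.residueField p) ⟶
      (aff (n + 1) X).sch => m q) key
    have h' : Sm.mor (affZero n X) (Sm.mor (affDrop n X)
      ((aff (n + 1) X).sch.fromSpecResidueField p q)) =
        (aff (n + 1) X).sch.fromSpecResidueField p q := h
    rwa [Scheme.fromSpecResidueField_apply] at h'

/-- The stabilisation `(Z, W, φ, g) ↦ (0 × Z, 𝔸¹ × W, σ(x, φ), g)`, where `x` is the coordinate on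
`𝔸¹`. Here `𝔸¹ × W` is the pullback of `W` along the projection `𝔸¹⁺ⁿ_X ⟶ 𝔸ⁿ_X`. -/
def susp (σ : T.SuspHom T') (c : Corr T n X Y) : Corr T' (n + 1) X Y where
  Z := suspSupport c.Z
  finite := by
    refine IsFiniteOver.of_image (i := Sm.mor (affZero n X)) (Z := c.Z) rfl ?_
    rw [← Sm.mor_comp, affZero_proj]
    exact c.finite
  W := etPull c.e c.nbhd.etale (affDrop n X)
  e := etPull.snd _ _ _
  nbhd := c.nbhd.of_isPullback (etPull.isPullback _ _ _) fun z hz =>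
    ((mem_suspSupport c.Z z).mp hz).2
  φ := σ.app (Sm.res (etPull.snd c.e c.nbhd.etale (affDrop n X)) (affCoord (n + 1) X 0))
    (T.F.map (Sm.mor (etPull.fst c.e c.nbhd.etale (affDrop n X))).op c.φ)
  zero w := by
    rw [σ.isZero_app, mem_suspSupport, T.isZero_map, c.zero, ← Scheme.Hom.comp_apply,
      ← Scheme.Hom.comp_apply, ← Sm.mor_comp, ← Sm.mor_comp, etPull.condition]
    exact and_congr_left fun _ => notMem_basicOpen_appTop _ _ _
  g := Y.map (etPull.fst _ _ _).op c.g

/-- The projection to the original étale neighbourhood. -/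
def suspFst (σ : T.SuspHom T') (c : Corr T n X Y) : (c.susp σ).W ⟶ c.W := etPull.fst c.e c.nbhd.etale (affDrop n X)

lemma susp_condition (σ : T.SuspHom T') (c : Corr T n X Y) :
    c.suspFst σ ≫ c.e = (c.susp σ).e ≫ affDrop n X := etPull.condition c.e c.nbhd.etale (affDrop n X)

lemma susp_φ (σ : T.SuspHom T') (c : Corr T n X Y) :
    (c.susp σ).φ = σ.app (Sm.res (c.susp σ).e (affCoord (n + 1) X 0))
      (T.F.map (Sm.mor (c.suspFst σ)).op c.φ) := rfl

lemma susp_g (σ : T.SuspHom T') (c : Corr T n X Y) :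
    (c.susp σ).g = Y.map (c.suspFst σ).op c.g := rfl

lemma susp_Z (σ : T.SuspHom T') (c : Corr T n X Y) : (c.susp σ).Z = suspSupport c.Z := rfl

lemma exists_suspLift (σ : T.SuspHom T') (c : Corr T n X Y) {B : Sm k} (a : B ⟶ c.W)
    (b : B ⟶ aff (n + 1) X) (h : a ≫ c.e = b ≫ affDrop n X) :
    ∃ i : B ⟶ (c.susp σ).W, i ≫ c.suspFst σ = a ∧ i ≫ (c.susp σ).e = b :=
  ⟨etPull.lift c.nbhd.etale a b h, etPull.lift_fst c.nbhd.etale a b h, etPull.lift_snd c.nbhd.etale a b h⟩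

lemma Refines.susp (σ : T.SuspHom T') {c' c : Corr T n X Y} (h : c'.Refines c) :
    (c'.susp σ).Refines (c.susp σ) := by
  obtain ⟨hZ, i, he, hφ, hg⟩ := h
  obtain ⟨i', h1, h2⟩ := exists_suspLift σ c (c'.suspFst σ ≫ i) (c'.susp σ).e (by
    rw [Category.assoc, he, susp_condition])
  refine ⟨congrArg suspSupport hZ, i', h2, ?_, ?_⟩
  · rw [susp_φ, susp_φ, ← hφ]
    refine (σ.natural _ _ _).trans (congrArg₂ _ ?_ ?_)
    · refine (Sm.res_comp _ _ _).symm.trans ?_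
      rw [h2]
    · exact F_map_congr T h1 _
  · rw [susp_g, susp_g, ← hg]
    exact Y_map_congr Y h1 _

lemma susp_baseChange_refines (σ : T.SuspHom T') (f : X' ⟶ X) (c : Corr T n X Y) :
    ((c.baseChange f).susp σ).Refines ((c.susp σ).baseChange f) := by
  obtain ⟨a, a1, a2⟩ := exists_suspLift σ c ((c.baseChange f).suspFst σ ≫ c.bcFst f)
    (((c.baseChange f).susp σ).e ≫ affMap (n + 1) f) (by
      rw [Category.assoc, bc_condition, Category.assoc, affMap_drop, ← Category.assoc,
        ← Category.assoc, susp_condition])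
  obtain ⟨i, h1, h2⟩ := exists_bcLift f (c.susp σ) a ((c.baseChange f).susp σ).e a2
  refine ⟨?_, i, h2, ?_, ?_⟩
  · ext p
    change p ∈ ((c.baseChange f).susp σ).Z ↔ p ∈ ((c.susp σ).baseChange f).Z
    rw [susp_Z, mem_bc_Z, susp_Z, mem_suspSupport, mem_suspSupport, mem_bc_Z,
      ← notMem_basicOpen_appTop, ← Scheme.Hom.comp_apply, ← Scheme.Hom.comp_apply,
      ← Sm.mor_comp, ← Sm.mor_comp, affMap_drop]
    have h : (Sm.mor (affMap (n + 1) f)).appTop (affCoord (n + 1) X 0) =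
      affCoord (n + 1) X' 0 := affMap_coord (n + 1) f 0
    rw [h]
  · rw [bc_φ, susp_φ, susp_φ, bc_φ, σ.natural, σ.natural]
    refine congrArg₂ _ ?_ ?_
    · change Sm.res i (Sm.res ((c.susp σ).bcFst f) (Sm.res (c.susp σ).e
        (affCoord (n + 1) X 0))) = _
      rw [← Sm.res_comp, h1, ← Sm.res_comp, a2, Sm.res_comp, affMap_coord]
    · rw [← F_map_comp, ← F_map_comp, ← F_map_comp, ← a1, ← h1, Category.assoc]
  · rw [bc_g, susp_g, susp_g, bc_g, ← Y_map_comp, ← Y_map_comp, ← Y_map_comp, ← a1, ← h1,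
      Category.assoc]

lemma susp_mapPresheaf (σ : T.SuspHom T') (α : Y ⟶ Y') (c : Corr T n X Y) :
    (c.mapPresheaf α).susp σ = (c.susp σ).mapPresheaf α := by
  simp only [mapPresheaf, susp]
  congr 1
  exact nat_apply α _ _

end Corr

/-- The set of correspondences of level `n` framed in `T`: equivalence classes of explicit ones. -/
def Fr (T : FramingTarget.{u}) (n : ℕ) (X : Sm k) (Y : (Sm k)ᵒᵖ ⥤ Type w) :=
  Quot (Corr.Equivalent (T := T) (n := n) (X := X) (Y := Y))

namespace Fr

variable {T T' : FramingTarget.{u}} {n : ℕ} {X : Sm k} {Y : (Sm k)ᵒᵖ ⥤ Type w}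

/-- The class of an explicit correspondence. -/
def mk (c : Corr T n X Y) : Fr T n X Y := Quot.mk _ c

lemma sound {c' c : Corr T n X Y} (h : c'.Refines c) : mk c' = mk c :=
  Quot.sound ⟨c', .refl c', h⟩

/-- The composition with a map of framing targets. -/
def mapTarget (η : T.Hom T') : Fr T n X Y → Fr T' n X Y :=
  Quot.map (Corr.mapTarget η) fun _ _ ⟨c, h, h'⟩ => ⟨c.mapTarget η, h.mapTarget η, h'.mapTarget η⟩

/-- The stabilisation in `n`. -/
def susp (σ : T.SuspHom T') : Fr T n X Y → Fr T' (n + 1) X Y :=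
  Quot.map (Corr.susp σ) fun _ _ ⟨c, h, h'⟩ => ⟨c.susp σ, h.susp σ, h'.susp σ⟩

end Fr

/-- `Fr_n(X, Y)`: framed correspondences of level `n`. -/
abbrev FrN (n : ℕ) (X : Sm k) (Y : (Sm k)ᵒᵖ ⥤ Type w) := Fr (affTarget.{u} n) n X Y

/-- `Fr^cob_{n,N}(X, Y)`: cobordism-framed correspondences of level `(n, N)`. -/
abbrev FrCob (n N : ℕ) (X : Sm k) (Y : (Sm k)ᵒᵖ ⥤ Type w) := Fr (tautTarget.{u} n N) n X Y

/-! ### Stable linear correspondences -/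

/-- A family of framing targets `T n j` for correspondences of level `n`, with the stabilisation
maps `T n j ⟶ T n (up j)` and `𝔸¹ × T n j ⟶ T (1 + n) j`. -/
structure FramingSystem where
  /-- the second index -/
  J : Type
  /-- the targets -/
  T : ℕ → J → FramingTarget.{u}
  /-- the shift of the second index -/
  up : J → J
  /-- the stabilisation in the second index -/
  inc (n : ℕ) (j : J) : (T n j).Hom (T n (up j))
  /-- the stabilisation in `n` -/
  susp (n : ℕ) (j : J) : (T n j).SuspHom (T (n + 1) j)

/-- The identity map of a framing target. -/
def FramingTarget.Hom.id (T : FramingTarget.{u}) : T.Hom T where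
  app t := t
  natural _ _ := rfl
  isZero_app _ _ := Iff.rfl

/-- Framed correspondences: the targets `𝔸ⁿ`, with stabilisation in `n` only. -/
def framed : FramingSystem.{u} where
  J := Unit
  T n _ := affTarget n
  up j := j
  inc _ _ := .id _
  susp n _ := affSusp n

/-- Cobordism-framed correspondences: the targets `τ_{n,n+N}`, with stabilisation in `n` and
`N`. -/
def cobFramed : FramingSystem.{u} where
  J := ℕ
  T n N := tautTarget n (n + N)
  up N := N + 1
  inc n N := tautInc n N
  susp n N := tautSusp n N

/-- The stabilisation maps of a framing system. -/
inductive StabRel (S : FramingSystem.{u}) (X : Sm k) (Y : (Sm k)ᵒᵖ ⥤ Type w) :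
    (Σ (n : ℕ) (j : S.J), Fr (S.T n j) n X Y) → (Σ (n : ℕ) (j : S.J), Fr (S.T n j) n X Y) → Prop
  | inc (n : ℕ) (j : S.J) (c : Fr (S.T n j) n X Y) :
      StabRel S X Y ⟨n, j, c⟩ ⟨n, S.up j, c.mapTarget (S.inc n j)⟩
  | susp (n : ℕ) (j : S.J) (c : Fr (S.T n j) n X Y) :
      StabRel S X Y ⟨n, j, c⟩ ⟨n + 1, j, c.susp (S.susp n j)⟩

/-- The set of stable correspondences: the colimit of the sets of correspondences of finite level
along the stabilisation maps. -/
def FrStable (S : FramingSystem.{u}) (X : Sm k) (Y : (Sm k)ᵒᵖ ⥤ Type w) := Quot (StabRel S X Y)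

/-- The stable class of an explicit correspondence. -/
def FrStable.mk (S : FramingSystem.{u}) {X : Sm k} {Y : (Sm k)ᵒᵖ ⥤ Type w} {n : ℕ} {j : S.J}
    (c : Corr (S.T n j) n X Y) : FrStable S X Y := Quot.mk _ ⟨n, j, Fr.mk c⟩

lemma Fr.lift_aux {T : FramingTarget.{u}} {n : ℕ} {X : Sm k} {Y : (Sm k)ᵒᵖ ⥤ Type w} {A : Type*}
    {F : Corr T n X Y → A} (h : ∀ c' c : Corr T n X Y, c'.Refines c → F c' = F c)
    (c₁ c₂ : Corr T n X Y) (h' : c₁.Equivalent c₂) : F c₁ = F c₂ := by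
  obtain ⟨c, h₁, h₂⟩ := h'
  exact (h _ _ h₁).symm.trans (h _ _ h₂)

/-- A map out of `FrStable` is given by its values on explicit correspondences. -/
def FrStable.lift {S : FramingSystem.{u}} {X : Sm k} {Y : (Sm k)ᵒᵖ ⥤ Type w} {A : Type*}
    (F : ∀ (n : ℕ) (j : S.J), Corr (S.T n j) n X Y → A)
    (h₁ : ∀ (n : ℕ) (j : S.J) (c' c : Corr (S.T n j) n X Y), c'.Refines c → F n j c' = F n j c)
    (h₂ : ∀ (n : ℕ) (j : S.J) (c : Corr (S.T n j) n X Y),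
      F n (S.up j) (c.mapTarget (S.inc n j)) = F n j c)
    (h₃ : ∀ (n : ℕ) (j : S.J) (c : Corr (S.T n j) n X Y),
      F (n + 1) j (c.susp (S.susp n j)) = F n j c) : FrStable S X Y → A :=
  Quot.lift (fun x => Quot.lift (F x.1 x.2.1) (Fr.lift_aux (h₁ x.1 x.2.1)) x.2.2) (by
    rintro _ _ (⟨n, j, c⟩ | ⟨n, j, c⟩)
    · obtain ⟨c, rfl⟩ := Quot.exists_rep c
      exact (h₂ n j c).symm
    · obtain ⟨c, rfl⟩ := Quot.exists_rep c
      exact (h₃ n j c).symm)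

/-- The additivity relations `[c₁] + [c₂] = [c₁ ⨿ c₂]`. -/
def additivityRelations (S : FramingSystem.{u}) (X : Sm k) (Y : (Sm k)ᵒᵖ ⥤ Type w) :
    Set (FreeAbelianGroup (FrStable S X Y)) :=
  {x | ∃ (n : ℕ) (j : S.J) (c c₁ c₂ : Corr (S.T n j) n X Y), c.IsDisjointSum c₁ c₂ ∧
    x = FreeAbelianGroup.of (FrStable.mk S c₁) + FreeAbelianGroup.of (FrStable.mk S c₂) -
      FreeAbelianGroup.of (FrStable.mk S c)}

/-- The group of stable linear correspondences: the abelian group with generators the stable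
correspondences and the additivity relations. -/
abbrev ZF (S : FramingSystem.{u}) (X : Sm k) (Y : (Sm k)ᵒᵖ ⥤ Type w) :=
  FreeAbelianGroup (FrStable S X Y) ⧸ AddSubgroup.closure (additivityRelations S X Y)

namespace ZF

variable {S S' : FramingSystem.{u}} {X X' X'' : Sm k} {Y Y' : (Sm k)ᵒᵖ ⥤ Type w}

/-- The class of an explicit correspondence. -/
def mk (S : FramingSystem.{u}) {X : Sm k} {Y : (Sm k)ᵒᵖ ⥤ Type w} {n : ℕ} {j : S.J}
    (c : Corr (S.T n j) n X Y) : ZF S X Y :=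
  QuotientAddGroup.mk (FreeAbelianGroup.of (FrStable.mk S c))

lemma mk_refines {n : ℕ} {j : S.J} {c' c : Corr (S.T n j) n X Y} (h : c'.Refines c) :
    mk S c' = mk S c := by
  unfold mk FrStable.mk
  rw [Fr.sound h]

lemma mk_inc {n : ℕ} {j : S.J} (c : Corr (S.T n j) n X Y) :
    mk S (c.mapTarget (S.inc n j)) = mk S c := by
  have h : FrStable.mk S c = FrStable.mk S (c.mapTarget (S.inc n j)) :=
    Quot.sound (StabRel.inc n j (Fr.mk c))
  unfold mk
  rw [h]

lemma mk_susp {n : ℕ} {j : S.J} (c : Corr (S.T n j) n X Y) :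
    mk S (c.susp (S.susp n j)) = mk S c := by
  have h : FrStable.mk S c = FrStable.mk S (c.susp (S.susp n j)) :=
    Quot.sound (StabRel.susp n j (Fr.mk c))
  unfold mk
  rw [h]

lemma mk_add {n : ℕ} {j : S.J} {c c₁ c₂ : Corr (S.T n j) n X Y} (h : c.IsDisjointSum c₁ c₂) :
    mk S c = mk S c₁ + mk S c₂ := by
  symm
  rw [← sub_eq_zero]
  exact (QuotientAddGroup.eq_zero_iff _).mpr
    (AddSubgroup.subset_closure ⟨n, j, c, c₁, c₂, h, rfl⟩)

lemma hom_ext {A : Type*} [AddCommGroup A] {f g : ZF S X Y →+ A}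
    (h : ∀ (n : ℕ) (j : S.J) (c : Corr (S.T n j) n X Y), f (mk S c) = g (mk S c)) : f = g := by
  apply QuotientAddGroup.addMonoidHom_ext
  apply FreeAbelianGroup.lift_ext
  intro x
  obtain ⟨⟨n, j, c⟩, rfl⟩ := Quot.exists_rep x
  obtain ⟨c, rfl⟩ := Quot.exists_rep c
  exact h n j c

/-- A homomorphism out of `ZF` is given by its values on explicit correspondences. -/
def lift {A : Type*} [AddCommGroup A] (F : ∀ (n : ℕ) (j : S.J), Corr (S.T n j) n X Y → A)
    (h₁ : ∀ (n : ℕ) (j : S.J) (c' c : Corr (S.T n j) n X Y), c'.Refines c → F n j c' = F n j c)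
    (h₂ : ∀ (n : ℕ) (j : S.J) (c : Corr (S.T n j) n X Y),
      F n (S.up j) (c.mapTarget (S.inc n j)) = F n j c)
    (h₃ : ∀ (n : ℕ) (j : S.J) (c : Corr (S.T n j) n X Y),
      F (n + 1) j (c.susp (S.susp n j)) = F n j c)
    (h₄ : ∀ (n : ℕ) (j : S.J) (c c₁ c₂ : Corr (S.T n j) n X Y), c.IsDisjointSum c₁ c₂ →
      F n j c = F n j c₁ + F n j c₂) : ZF S X Y →+ A :=
  QuotientAddGroup.lift _ (FreeAbelianGroup.lift (FrStable.lift F h₁ h₂ h₃)) (by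
    intro x hx
    refine (AddSubgroup.closure_le (K := AddMonoidHom.ker _)).mpr ?_ hx
    rintro _ ⟨n, j, c, c₁, c₂, h, rfl⟩
    have key (c : Corr (S.T n j) n X Y) : FreeAbelianGroup.lift (FrStable.lift F h₁ h₂ h₃)
        (FreeAbelianGroup.of (FrStable.mk S c)) = F n j c :=
      FreeAbelianGroup.lift_apply_of _ _
    rw [SetLike.mem_coe, AddMonoidHom.mem_ker, map_sub, map_add, key, key, key, sub_eq_zero]
    exact (h₄ n j c c₁ c₂ h).symm)

/-- The base change along `f : X' ⟶ X`. -/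
def baseChange (S : FramingSystem.{u}) (Y : (Sm k)ᵒᵖ ⥤ Type w) (f : X' ⟶ X) :
    ZF S X Y →+ ZF S X' Y :=
  lift (fun _ _ c => mk S (c.baseChange f))
    (fun _ _ _ _ h => mk_refines (h.baseChange f))
    (fun _ _ c => by rw [Corr.mapTarget_baseChange, mk_inc])
    (fun _ _ c => by rw [← mk_refines (c.susp_baseChange_refines _ f), mk_susp])
    (fun _ _ _ _ _ h => mk_add (h.baseChange f))

lemma baseChange_mk (f : X' ⟶ X) {n : ℕ} {j : S.J} (c : Corr (S.T n j) n X Y) :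
    baseChange S Y f (mk S c) = mk S (c.baseChange f) := rfl

/-- The composition with a map of presheaves. -/
def mapPresheaf (S : FramingSystem.{u}) (X : Sm k) (α : Y ⟶ Y') : ZF S X Y →+ ZF S X Y' :=
  lift (fun _ _ c => mk S (c.mapPresheaf α))
    (fun _ _ _ _ h => mk_refines (h.mapPresheaf α))
    (fun _ _ c => mk_inc (c.mapPresheaf α))
    (fun _ _ c => by rw [← Corr.susp_mapPresheaf, mk_susp])
    (fun _ _ _ _ _ h => mk_add (h.mapPresheaf α))

lemma mapPresheaf_mk (α : Y ⟶ Y') {n : ℕ} {j : S.J} (c : Corr (S.T n j) n X Y) :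
    mapPresheaf S X α (mk S c) = mk S (c.mapPresheaf α) := rfl

end ZF

/-- The presheaf of abelian groups `X ↦ ZF(X, Y)`. -/
def zf (S : FramingSystem.{u}) (Y : (Sm k)ᵒᵖ ⥤ Type w) : (Sm k)ᵒᵖ ⥤ AddCommGrpCat where
  obj X := AddCommGrpCat.of (ZF S X.unop Y)
  map f := AddCommGrpCat.ofHom (ZF.baseChange S Y f.unop)
  map_id X := by
    apply AddCommGrpCat.hom_ext
    apply ZF.hom_ext
    intro n j c
    exact ZF.mk_refines c.baseChange_id_refines
  map_comp f g := by
    apply AddCommGrpCat.hom_ext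
    apply ZF.hom_ext
    intro n j c
    exact (ZF.mk_refines (c.baseChange_comp_refines g.unop f.unop)).symm

/-- The functoriality of `ZF(-, Y)` in the presheaf `Y`. -/
def zfMap (S : FramingSystem.{u}) {Y Y' : (Sm k)ᵒᵖ ⥤ Type w} (α : Y ⟶ Y') : zf S Y ⟶ zf S Y' where
  app X := AddCommGrpCat.ofHom (ZF.mapPresheaf S X.unop α)
  naturality X X' f := by
    apply AddCommGrpCat.hom_ext
    apply ZF.hom_ext
    intro n j c
    exact congrArg (ZF.mk S) (Corr.mapPresheaf_baseChange α f.unop c).symm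

/-! ### From framed to cobordism-framed correspondences -/

lemma TautDatum.proj_inc {R : Type u} [CommRing R] {n N : ℕ} (h : n ≤ N) (v : Fin n → R) :
    (TautDatum.proj h v).inc = TautDatum.proj (h.trans (Nat.le_succ N)) v := by
  ext i j
  · refine Fin.lastCases ?_ (fun j => ?_) j
    · have : ¬ (i : ℕ) = N := by have := i.2; omega
      simp [TautDatum.inc, TautDatum.proj, this]
    · simp [TautDatum.inc, TautDatum.proj]
  · rfl

lemma TautDatum.proj_susp {R : Type u} [CommRing R] {n N : ℕ} (h : n ≤ N) (x : R)
    (v : Fin n → R) :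
    (TautDatum.proj h v).susp x = TautDatum.proj (Nat.succ_le_succ h) (Fin.cons x v) := by
  ext i j
  · refine Fin.cases ?_ (fun i => ?_) i <;> refine Fin.cases ?_ (fun j => ?_) j <;>
      simp [TautDatum.susp, TautDatum.proj, TautDatum.oneBlock]
  · rfl

lemma tautFibre_inc (n N : ℕ) {W : Scheme.{u}} (φ : Fin n → Γ(W, ⊤)) :
    (tautInc n N).app ((tautFibre n N).app φ) = (tautFibre n (N + 1)).app φ := by
  apply TautMap.ext
  funext w
  refine congrArg TautClass.mk ?_
  change (TautDatum.map _ (TautDatum.proj _ φ)).inc = TautDatum.map _ (TautDatum.proj _ φ)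
  rw [← TautDatum.map_inc, TautDatum.proj_inc]

lemma tautFibre_susp (n N : ℕ) {W : Scheme.{u}} (x : Γ(W, ⊤)) (φ : Fin n → Γ(W, ⊤)) :
    (tautFibre (n + 1) N).app ((affSusp n).app x φ) =
      (tautSusp n N).app x ((tautFibre n N).app φ) := by
  apply TautMap.ext
  funext w
  refine congrArg TautClass.mk ?_
  change TautDatum.map _ (TautDatum.proj _ (Fin.cons x φ : Fin (n + 1) → Γ(W, ⊤))) =
    ((TautDatum.map _ (TautDatum.proj _ φ)).susp _).cast _
  rw [← TautDatum.map_susp, TautDatum.proj_susp, ← TautDatum.map_cast]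
  rfl

/-- The map `cob_{n,n+N} : Fr_n(X, Y) ⟶ Fr^cob_{n,n+N}(X, Y)`, `(Z, W, φ, g) ↦ (Z, W, i ∘ φ, g)`,
on explicit correspondences. -/
def Corr.cob (N : ℕ) {n : ℕ} {X : Sm k} {Y : (Sm k)ᵒᵖ ⥤ Type w} (c : Corr (affTarget n) n X Y) :
    Corr (tautTarget n (n + N)) n X Y :=
  c.mapTarget (tautFibre n N)

lemma Corr.cob_inc (N : ℕ) {n : ℕ} {X : Sm k} {Y : (Sm k)ᵒᵖ ⥤ Type w}
    (c : Corr (affTarget n) n X Y) : (c.cob N).mapTarget (tautInc n N) = c.cob (N + 1) := by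
  simp only [Corr.cob, Corr.mapTarget]
  congr 1
  exact tautFibre_inc n N c.φ

lemma Corr.cob_susp (N : ℕ) {n : ℕ} {X : Sm k} {Y : (Sm k)ᵒᵖ ⥤ Type w}
    (c : Corr (affTarget n) n X Y) :
    (c.susp (affSusp n)).cob N = (c.cob N).susp (tautSusp n N) := by
  simp only [Corr.cob, Corr.mapTarget, Corr.susp]
  congr 1
  exact (tautFibre_susp n N _ _).trans
    (congrArg ((tautSusp n N).app _) ((tautFibre n N).natural _ _).symm)

/-- The homomorphism `ℤcob : ZF(X, Y) ⟶ ZF^cob(X, Y)` induced by the maps `cob_{n,n+N}`. -/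
def ZF.cob (X : Sm k) (Y : (Sm k)ᵒᵖ ⥤ Type w) : ZF framed X Y →+ ZF cobFramed X Y :=
  ZF.lift (fun n _ c => ZF.mk cobFramed (n := n) (j := (0 : ℕ)) (Corr.cob 0 c))
    (fun n _ _ _ h => ZF.mk_refines (S := cobFramed) (j := (0 : ℕ)) (h.mapTarget (tautFibre n 0)))
    (fun _ _ _ => rfl)
    (fun n _ c => (congrArg (ZF.mk cobFramed (n := n + 1) (j := (0 : ℕ))) (Corr.cob_susp 0 c)).trans
      (ZF.mk_susp (S := cobFramed) (j := (0 : ℕ)) (Corr.cob 0 c)))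
    (fun n _ _ _ _ h => ZF.mk_add (S := cobFramed) (j := (0 : ℕ)) (h.mapTarget (tautFibre n 0)))

/-- On explicit correspondences of level `n`, `ℤcob` is induced by `cob_{n,n+N}` for each `N`. -/
lemma ZF.cob_mk {X : Sm k} {Y : (Sm k)ᵒᵖ ⥤ Type w} {n : ℕ} (c : Corr (affTarget n) n X Y)
    (N : ℕ) : ZF.cob X Y (ZF.mk framed (n := n) (j := ()) c) =
      ZF.mk cobFramed (n := n) (j := N) (c.cob N) := by
  induction N with
  | zero => rfl
  | succ N ih =>
    rw [ih, ← Corr.cob_inc]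
    exact (ZF.mk_inc (S := cobFramed) (j := N) (c.cob N)).symm

/-- The homomorphism `ℤcob` as a map of presheaves in `X`. -/
def zfCob (Y : (Sm k)ᵒᵖ ⥤ Type w) : zf framed Y ⟶ zf cobFramed Y where
  app X := AddCommGrpCat.ofHom (ZF.cob X.unop Y)
  naturality X X' f := by
    apply AddCommGrpCat.hom_ext
    apply ZF.hom_ext
    intro n j c
    exact congrArg (ZF.mk cobFramed (n := n) (j := (0 : ℕ)))
      (Corr.mapTarget_baseChange (tautFibre n 0) f.unop c).symm

lemma zfCob_natural {Y Y' : (Sm k)ᵒᵖ ⥤ Type w} (α : Y ⟶ Y') :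
    zfMap framed α ≫ zfCob Y' = zfCob Y ≫ zfMap cobFramed α := by
  apply NatTrans.ext
  funext X
  apply AddCommGrpCat.hom_ext
  apply ZF.hom_ext
  intro n j c
  rfl

/-! ### The complexes -/

/-- The complex `C_* F (X)` of a presheaf of abelian groups `F`: the alternating sum complex of the
simplicial abelian group `F(Δ^•_k × X)`. -/
def cStar (F : (Sm k)ᵒᵖ ⥤ AddCommGrpCat.{w}) (X : Sm k) : ChainComplex AddCommGrpCat.{w} ℕ :=
  (AlgebraicTopology.alternatingFaceMapComplex AddCommGrpCat.{w}).obj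
    ((simplexFunctor k ⋙ Sm.prodRight X).op ⋙ F)

/-- The functoriality of `C_* F (X)` in `F`. -/
def cStarMap {F G : (Sm k)ᵒᵖ ⥤ AddCommGrpCat.{w}} (η : F ⟶ G) (X : Sm k) :
    cStar F X ⟶ cStar G X :=
  (AlgebraicTopology.alternatingFaceMapComplex AddCommGrpCat.{w}).map
    (Functor.whiskerLeft (simplexFunctor k ⋙ Sm.prodRight X).op η)

/-- The group `H⁰(C_* F (X))`. -/
def H0 (F : (Sm k)ᵒᵖ ⥤ AddCommGrpCat.{w}) (X : Sm k) : AddCommGrpCat.{w} :=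
  (cStar F X).homology 0

/-- The functoriality of `H⁰(C_* F (X))` in `F`. -/
def H0Map {F G : (Sm k)ᵒᵖ ⥤ AddCommGrpCat.{w}} (η : F ⟶ G) (X : Sm k) : H0 F X ⟶ H0 G X :=
  HomologicalComplex.homologyMap (cStarMap η X) 0

/-- The homomorphism `H⁰(C_* ZF(X, Y)) ⟶ H⁰(C_* ZF^cob(X, Y))` induced by `ℤcob`. -/
def HcobTilde (X : Sm k) (Y : (Sm k)ᵒᵖ ⥤ Type w) :
    H0 (zf framed Y) X ⟶ H0 (zf cobFramed Y) X :=
  H0Map (zfCob Y) X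

/-! ### The summands for smash powers of the multiplicative group -/

/-- The presheaf represented by `𝔾_m^m`: a morphism `W ⟶ 𝔾_m^m` is an `m`-tuple of invertible
functions on `W`. -/
def gmPow (k : Type u) [Field k] (m : ℕ) : (Sm k)ᵒᵖ ⥤ Type u where
  obj W := Fin m → (Γ(W.unop.sch, ⊤))ˣ
  map f := TypeCat.ofHom fun x i => Units.map (Sm.res f.unop).toMonoidHom (x i)
  map_id W := by ext; rfl
  map_comp f g := by ext; rfl

/-- The endomorphism of `𝔾_m^m` which is the composition `𝔾_m ⟶ pt ⟶ 𝔾_m` with the point `1` on the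
`i`-th factor and the identity on the other factors. -/
def gmIdem (k : Type u) [Field k] {m : ℕ} (i : Fin m) : gmPow k m ⟶ gmPow k m where
  app W := TypeCat.ofHom fun x => Function.update x i 1
  naturality W W' f := by
    ext x
    funext j
    let u : (Γ(W.unop.sch, ⊤))ˣ →* (Γ(W'.unop.sch, ⊤))ˣ := Units.map (Sm.res f.unop).toMonoidHom
    change Function.update (fun j => Units.map (Sm.res f.unop).toMonoidHom (x j)) i 1 j =
      Units.map (Sm.res f.unop).toMonoidHom (Function.update x i 1 j)
    by_cases h : j = i
    · subst h
      exact (Function.update_self _ _ _).trans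
        ((congrArg u (Function.update_self j (1 : (Γ(W.unop.sch, ⊤))ˣ) x)).trans (map_one u)).symm
    · exact (Function.update_of_ne h _ _).trans
        (congrArg u (Function.update_of_ne h _ _)).symm

/-- The endomorphism `(1 - e₁) ⋯ (1 - e_m)` of `ZF(-, 𝔾_m^m)`, where `e_i` is the composition with
`gmIdem k i`. The `e_i` are commuting idempotents. -/
def smashIdem (k : Type u) [Field k] (S : FramingSystem.{u}) (m : ℕ) : End (zf S (gmPow k m)) :=
  (List.ofFn fun i : Fin m => (1 : End (zf S (gmPow k m))) - End.of (zfMap S (gmIdem k i))).prod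

/-- The image of an endomorphism `p` of a presheaf of abelian groups. -/
def image {C : Type*} [Category* C] {F : C ⥤ AddCommGrpCat.{w}} (p : F ⟶ F) :
    C ⥤ AddCommGrpCat.{w} where
  obj X := AddCommGrpCat.of (p.app X).hom.range
  map {X X'} f := AddCommGrpCat.ofHom (((F.map f).hom.comp (p.app X).hom.range.subtype).codRestrict
    (p.app X').hom.range (by
      rintro ⟨_, x, rfl⟩
      exact ⟨F.map f x, NatTrans.naturality_apply p f x⟩))
  map_id X := by
    apply AddCommGrpCat.hom_ext
    ext x
    simp
  map_comp f g := by
    apply AddCommGrpCat.hom_ext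
    ext x
    simp

/-- The map of images induced by a map commuting with the endomorphisms. -/
def imageMap {C : Type*} [Category* C] {F G : C ⥤ AddCommGrpCat.{w}} {p : F ⟶ F} {q : G ⟶ G}
    (η : F ⟶ G) (h : p ≫ η = η ≫ q) : image p ⟶ image q where
  app X := AddCommGrpCat.ofHom (((η.app X).hom.comp (p.app X).hom.range.subtype).codRestrict
    (q.app X).hom.range (by
      rintro ⟨_, x, rfl⟩
      refine ⟨η.app X x, ?_⟩
      have := congrArg (fun α : F ⟶ G => α.app X x) h
      exact this.symm))
  naturality X X' f := by
    apply AddCommGrpCat.hom_ext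
    refine AddMonoidHom.ext fun x => Subtype.ext ?_
    exact NatTrans.naturality_apply η f x.1

/-- The direct summand `ZF(-, 𝔾_m^{∧m})` of `ZF(-, 𝔾_m^m)`, split out by the idempotent
`(1 - e₁) ⋯ (1 - e_m)`. -/
def zfSmash (k : Type u) [Field k] (S : FramingSystem.{u}) (m : ℕ) : (Sm k)ᵒᵖ ⥤ AddCommGrpCat :=
  image (smashIdem k S m)

lemma smashIdem_cob (k : Type u) [Field k] (m : ℕ) :
    smashIdem k framed m ≫ zfCob (gmPow k m) = zfCob (gmPow k m) ≫ smashIdem k cobFramed m := by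
  unfold smashIdem
  rw [List.ofFn_eq_map, List.ofFn_eq_map]
  induction List.finRange m with
  | nil => exact (Category.id_comp _).trans (Category.comp_id _).symm
  | cons i l ih =>
    rw [List.map_cons, List.map_cons, List.prod_cons, List.prod_cons, End.mul_def, End.mul_def,
      Category.assoc]
    have h : ((1 : End (zf framed (gmPow k m))) - End.of (zfMap framed (gmIdem k i))) ≫
          zfCob (gmPow k m) = zfCob (gmPow k m) ≫
        ((1 : End (zf cobFramed (gmPow k m))) - End.of (zfMap cobFramed (gmIdem k i))) := by
      change (𝟙 _ - zfMap framed (gmIdem k i)) ≫ zfCob (gmPow k m) =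
        zfCob (gmPow k m) ≫ (𝟙 _ - zfMap cobFramed (gmIdem k i))
      rw [Preadditive.sub_comp, Preadditive.comp_sub, zfCob_natural, Category.id_comp,
        Category.comp_id]
    rw [h, ← Category.assoc, ih, Category.assoc]

/-- The homomorphism `H⁰(C_* ZF(X, 𝔾_m^{∧m})) ⟶ H⁰(C_* ZF^cob(X, 𝔾_m^{∧m}))`, the direct summand of
`HcobTilde X (gmPow k m)`. -/
def Hcob (X : Sm k) (m : ℕ) : H0 (zfSmash k framed m) X ⟶ H0 (zfSmash k cobFramed m) X :=
  H0Map (imageMap (zfCob (gmPow k m)) (smashIdem_cob k m)) X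

end

end CobFr

namespace CobFr

open CategoryTheory Limits Opposite TopologicalSpace AlgebraicGeometry

/-! A cobordism framing carries more than a framing only in the epimorphism `𝒪^N ⟶ E`. Once `E` is
trivial, it is a pair `(A, v)` of a right invertible matrix and a vector of functions, and the
support is the zero locus of `v` alone. So `v` already defines a framed correspondence, while `A`
may be moved freely among right invertible matrices. It remains to trivialise `E` near the support
and to deform `A` to the standard projection `P`, for which the correspondence comes from a framed
one.

Trivialisation. Over the point the support is a finite set. Since `k` is infinite, the columns of
some matrix `B` with entries in `k` give a basis of the fibre of `E` at each of its points: every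
point asks for the non-vanishing of a determinant which is not identically zero on matrices over `k`
(`exists_forall_det_mul_map_ne_zero`). The locus where `B` gives a basis is open. On it the
condition `A * B = 1` singles out one matrix in each class, so local matrices glue and `E` is free
(`TautMap.exists_eq_ofDatum`). Shrinking the étale neighbourhood to this locus does not change the
class (`Corr.exists_refines_ofDatum`).

Deformation. If `A₀ * B = 1` and `A₁ * B = 1`, then `B` is a right inverse of `A₀ + t (A₁ - A₀)` for
every `t`, which is a homotopy over `Δ¹` (`Corr.exists_linear_homotopy`). The matrices `A` and `P`
need not have a common right inverse. After stabilisation by `n` zero columns, however, `(A | 0)`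
and `(0 | 1)` share the right inverse with blocks `B` and `1`, and `(0 | 1)` and `(P | 0)` share the
one with blocks `C` and `1`, where `P * C = 1`. Two linear homotopies therefore join the given
correspondence to a framed one (`ZF.cob_range_sup_eq_top`).

Thus every `0`-chain is a framed chain plus a boundary. All `0`-chains are cycles, so this is
surjectivity on `H⁰` (`H0Map_surjective`). For the smash powers one applies the endomorphism cutting
out the summand to such a decomposition; it commutes with the comparison map and with the face maps.
-/

/-! ### Matrices over an infinite field in general position -/

/-- A matrix with a right inverse has a right multiple with entries in an infinite subfield whose
determinant is nonzero. -/
lemma exists_det_mul_map_ne_zero {k K : Type*} [Field k] [Infinite k] [Field K] (f : k →+* K)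
    {n m : ℕ} (A : Matrix (Fin n) (Fin m) K) (hA : Function.Surjective A.mulVec) :
    ∃ B : Matrix (Fin m) (Fin n) k, (A * B.map f).det ≠ 0 := by
  by_contra! h
  let A' : Matrix (Fin n) (Fin m) (MvPolynomial (Fin m × Fin n) K) := A.map MvPolynomial.C
  let G : Matrix (Fin m) (Fin n) (MvPolynomial (Fin m × Fin n) K) :=
    Matrix.of fun i j => MvPolynomial.X (i, j)
  -- `P` is the determinant for a generic matrix `G`. If it vanished at all matrices over the
  -- infinite subfield, it would be the zero polynomial.
  let P : MvPolynomial (Fin m × Fin n) K := (A' * G).det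
  have hP (x : Fin m × Fin n → K) :
      MvPolynomial.eval x P =
        (A * (Matrix.of fun i j => x (i, j) : Matrix (Fin m) (Fin n) K)).det := by
    refine (RingHom.map_det _ _).trans (congrArg Matrix.det ?_)
    ext i j
    rw [RingHom.mapMatrix_apply, Matrix.map_mul, Matrix.mul_apply, Matrix.mul_apply]
    simp [A', G]
  have h0 : P = 0 := by
    refine MvPolynomial.funext_set (fun _ => Set.range f)
      (fun _ => Set.infinite_range_of_injective f.injective) fun x hx => ?_
    choose b hb using fun i => hx i trivial
    rw [hP, map_zero, ← h (Matrix.of fun i j => b (i, j))]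
    congr 2
    ext i j
    simp [hb]
  -- At a right inverse of `A` with entries in `K` the polynomial takes the value `1`.
  obtain ⟨C, hC⟩ := Matrix.mulVec_surjective_iff_exists_right_inverse.mp hA
  have h1 := hP fun p => C p.1 p.2
  rw [h0, map_zero] at h1
  have h2 : (Matrix.of fun i j => C i j) = C := rfl
  rw [h2, hC, Matrix.det_one] at h1
  exact zero_ne_one h1

/-- If a matrix polynomial of degree one has nonzero determinant at some point, then so it has at
almost all points. -/
lemma finite_det_add_smul_eq_zero {K : Type*} [Field K] {n : ℕ} (M N : Matrix (Fin n) (Fin n) K)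
    (s : K) (h : (M + s • N).det ≠ 0) : {t : K | (M + t • N).det = 0}.Finite := by
  let P : Polynomial K :=
    (M.map Polynomial.C + (Polynomial.X : Polynomial K) • N.map Polynomial.C).det
  have hP (t : K) : P.eval t = (M + t • N).det := by
    rw [← Polynomial.coe_evalRingHom, RingHom.map_det]
    congr 1
    ext i j
    simpa using mul_comm (N i j) t
  have h0 : P ≠ 0 := by
    rintro e
    rw [← hP, e, Polynomial.eval_zero] at h
    exact h rfl
  refine (Polynomial.finite_setOfPred_isRoot h0).subset fun t ht => ?_
  exact (hP t).trans ht

/-- Each index excludes a proper Zariski closed set of matrices, and finitely many of these do not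
cover all matrices over an infinite field. By induction, a matrix `B₀` good for `s` and a matrix
`B₁` good for the new index are joined by a line, on which each index rules out only finitely many
parameters. -/
lemma exists_forall_det_mul_map_ne_zero {k ι : Type*} [Field k] [Infinite k] {K : ι → Type*}
    [∀ i, Field (K i)] (f : ∀ i, k →+* K i) {n m : ℕ} (A : ∀ i, Matrix (Fin n) (Fin m) (K i))
    (hA : ∀ i, Function.Surjective (A i).mulVec) (s : Finset ι) :
    ∃ B : Matrix (Fin m) (Fin n) k, ∀ i ∈ s, (A i * B.map (f i)).det ≠ 0 := by
  classical
  induction s using Finset.induction with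
  | empty => exact ⟨0, by simp⟩
  | insert j s hj ih =>
    obtain ⟨B₀, h₀⟩ := ih
    obtain ⟨B₁, h₁⟩ := exists_det_mul_map_ne_zero (f j) (A j) (hA j)
    have key (i : ι) (t : k) : A i * (B₀ + t • (B₁ - B₀)).map (f i) =
        A i * B₀.map (f i) + f i t • (A i * (B₁ - B₀).map (f i)) := by
      rw [← Matrix.mul_smul, ← Matrix.mul_add]
      congr 1
      ext
      simp
    have hfin : ∀ i ∈ insert j s,
        {t : k | (A i * (B₀ + t • (B₁ - B₀)).map (f i)).det = 0}.Finite := by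
      intro i hi
      -- The endpoint `t = 1` is `B₁`, good for the new index; the endpoint `t = 0` is `B₀`, good
      -- for the old ones.
      have h : ∃ t : k, (A i * (B₀ + t • (B₁ - B₀)).map (f i)).det ≠ 0 := by
        rcases Finset.mem_insert.mp hi with rfl | hi
        · exact ⟨1, by simpa using h₁⟩
        · exact ⟨0, by simpa using h₀ i hi⟩
      obtain ⟨t, ht⟩ := h
      rw [key] at ht
      -- The roots are counted in `K i` and pulled back to `k` along the injective `f i`.
      refine ((finite_det_add_smul_eq_zero _ _ _ ht).preimage (f i).injective.injOn).subset ?_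
      intro t' ht'
      rw [Set.mem_ofPred_eq, key] at ht'
      exact ht'
    obtain ⟨t, ht⟩ := ((insert j s).finite_toSet.biUnion hfin).exists_notMem
    exact ⟨B₀ + t • (B₁ - B₀), fun i hi h => ht (Set.mem_biUnion hi h)⟩

/-! ### Trivialising the bundle by a matrix of sections -/

namespace TautDatum

variable {R S : Type u} [CommRing R] [CommRing S] {n N : ℕ}

/-- If `B` maps to a basis of the target of the epimorphism, the datum may be expressed in this
basis. -/
lemma exists_equiv_mul_eq_one (d : TautDatum R n N) (B : Matrix (Fin N) (Fin n) R)
    (h : IsUnit (d.A * B)) : ∃ d' : TautDatum R n N, d ≈ d' ∧ d'.A * B = 1 := by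
  obtain ⟨M, hM⟩ := h
  have h1 : (M⁻¹.val * d.A) * B = 1 := by rw [Matrix.mul_assoc, ← hM, Units.inv_mul]
  exact ⟨⟨M⁻¹.val * d.A, M⁻¹.val.mulVec d.v,
    Matrix.mulVec_surjective_iff_exists_right_inverse.mpr ⟨B, h1⟩⟩, ⟨M⁻¹, rfl, rfl⟩, h1⟩

/-- If the data differ by the change of basis `M`, then `M = M * (d.A * B) = d'.A * B = 1`. This
rigidity is what allows local trivialisations to be glued. -/
lemma eq_of_equiv_of_mul_eq_one {d d' : TautDatum R n N} {B : Matrix (Fin N) (Fin n) R}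
    (h : d ≈ d') (hd : d.A * B = 1) (hd' : d'.A * B = 1) : d = d' := by
  obtain ⟨M, hA, hv⟩ := h
  have hM : M.val = 1 := by
    rw [hA, Matrix.mul_assoc, hd, Matrix.mul_one] at hd'
    exact hd'
  rw [hM, Matrix.one_mul] at hA
  rw [hM, Matrix.one_mulVec] at hv
  exact TautDatum.ext hA.symm hv.symm

lemma map_A_mul (f : R →+* S) (d : TautDatum R n N) (B : Matrix (Fin N) (Fin n) R) :
    (d.map f).A * B.map f = (d.A * B).map f := Matrix.map_mul.symm

end TautDatum

namespace TautClass

variable {R S : Type u} [CommRing R] [CommRing S] {n N : ℕ}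

/-- The epimorphism `Rᴺ ⟶ E` maps the columns of the matrix `B` to a basis of `E`. -/
def IsBasis (t : TautClass R n N) (B : Matrix (Fin N) (Fin n) R) : Prop :=
  ∃ d : TautDatum R n N, mk d = t ∧ IsUnit (d.A * B)

/-- Representatives of one class have matrices differing by an invertible left factor, so any of
them may be used to test the condition. -/
lemma isBasis_mk (d : TautDatum R n N) (B : Matrix (Fin N) (Fin n) R) :
    (mk d).IsBasis B ↔ IsUnit (d.A * B) := by
  refine ⟨?_, fun h => ⟨d, rfl, h⟩⟩
  rintro ⟨d', h, hd'⟩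
  obtain ⟨M, hA, -⟩ := Quotient.exact h
  rw [hA, Matrix.mul_assoc]
  exact M.isUnit.mul hd'

lemma IsBasis.map (f : R →+* S) {t : TautClass R n N} {B : Matrix (Fin N) (Fin n) R}
    (h : t.IsBasis B) : (map f t).IsBasis (B.map f) := by
  obtain ⟨d, rfl, hd⟩ := h
  refine ⟨d.map f, rfl, ?_⟩
  rw [TautDatum.map_A_mul]
  exact hd.map (RingHom.mapMatrix f)

end TautClass

/-- A family of germs of functions which is locally given by a function comes from a global
function. -/
lemma exists_germ_eq_of_locally {W : Scheme.{u}} (a : ∀ w : W, W.presheaf.stalk w)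
    (h : ∀ w : W, ∃ (U : W.Opens) (_ : w ∈ U) (s : Γ(W, U)),
      ∀ (x : W) (hx : x ∈ U), W.presheaf.germ U x hx s = a x) :
    ∃ s : Γ(W, ⊤), ∀ w : W, W.presheaf.germ ⊤ w trivial s = a w := by
  choose U hU s hs using h
  obtain ⟨g, hg, -⟩ := W.sheaf.existsUnique_gluing' U ⊤ (fun w => homOfLE le_top)
    -- On an overlap the local sections have the same germs, namely the values of `a`, hence they
    -- agree.
    (fun w _ => Opens.mem_iSup.mpr ⟨w, hU w⟩) s (by
      intro i j
      apply TopCat.Presheaf.section_ext W.sheaf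
      rintro z ⟨hi, hj⟩
      refine (W.presheaf.germ_res_apply _ _ _ _).trans ((hs i z hi).trans ?_)
      exact ((W.presheaf.germ_res_apply _ _ _ _).trans (hs j z hj)).symm)
  refine ⟨g, fun w => ?_⟩
  rw [← hs w w (hU w), ← hg w]
  exact (W.presheaf.germ_res_apply _ _ _ _).symm

namespace TautMap

variable {n N : ℕ} {W : Scheme.{u}}

/-- The germ at a point of a matrix of functions. -/
noncomputable abbrev germMatrix {m n : ℕ} (U : W.Opens) (B : Matrix (Fin m) (Fin n) Γ(W, U)) (w : W)
    (hw : w ∈ U) : Matrix (Fin m) (Fin n) (W.presheaf.stalk w) :=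
  B.map (W.presheaf.germ U w hw).hom

/-- The columns of `B` map to a basis of `E` at the point `w`. -/
def IsBasisAt (t : TautMap W n N) (B : Matrix (Fin N) (Fin n) Γ(W, ⊤)) (w : W) : Prop :=
  (t.germ w).IsBasis (germMatrix ⊤ B w trivial)

lemma germMatrix_res {m n : ℕ} (B : Matrix (Fin m) (Fin n) Γ(W, ⊤)) {U : W.Opens} (w : W)
    (hw : w ∈ U) :
    germMatrix U (B.map (W.presheaf.map (homOfLE le_top : U ⟶ ⊤).op).hom) w hw =
      germMatrix ⊤ B w trivial := by
  ext i j
  exact W.presheaf.germ_res_apply _ _ _ _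

/-- Where the bundle is trivialised with matrix `A`, the columns of `B` give a basis exactly where
the function `det (A * B)` is invertible. -/
lemma isOpen_isBasisAt (t : TautMap W n N) (B : Matrix (Fin N) (Fin n) Γ(W, ⊤)) :
    IsOpen {w | t.IsBasisAt B w} := by
  rw [isOpen_iff_forall_mem_open]
  intro w hw
  obtain ⟨U, hU, d, hd⟩ := t.locally_trivial w
  let f := (d.A * B.map (W.presheaf.map (homOfLE le_top : U ⟶ ⊤).op).hom).det
  have key (x : W) (hx : x ∈ U) : t.IsBasisAt B x ↔ x ∈ W.basicOpen f := by
    unfold IsBasisAt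
    rw [hd x hx, TautClass.isBasis_mk, Scheme.mem_basicOpen W f x hx, ← germMatrix_res B x hx,
      TautDatum.map_A_mul, Matrix.isUnit_iff_isUnit_det]
    exact iff_of_eq (congrArg IsUnit (RingHom.map_det _ _).symm)
  exact ⟨W.basicOpen f, fun x hx => (key x (W.basicOpen_le f hx)).mpr hx, (W.basicOpen f).isOpen,
    (key w hU).mp hw⟩

lemma IsBasisAt.pull {W' : Scheme.{u}} (f : W' ⟶ W) {t : TautMap W n N}
    {B : Matrix (Fin N) (Fin n) Γ(W, ⊤)} {w : W'} (h : t.IsBasisAt B (f w)) :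
    (t.pull f).IsBasisAt (B.map f.appTop.hom) w := by
  have h1 := TautClass.IsBasis.map (f.stalkMap w).hom h
  have h2 : germMatrix ⊤ (B.map f.appTop.hom) w trivial =
      (germMatrix ⊤ B (f w) trivial).map (f.stalkMap w).hom := by
    ext i j
    exact (Scheme.Hom.germ_stalkMap_apply f ⊤ w trivial (B i j)).symm
  unfold IsBasisAt
  rw [h2]
  exact h1

/-- If the columns of `B` map to a basis of `E` at all points, then `E` is trivial. -/
lemma exists_eq_ofDatum (t : TautMap W n N) (B : Matrix (Fin N) (Fin n) Γ(W, ⊤))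
    (h : ∀ w, t.IsBasisAt B w) : ∃ d : TautDatum Γ(W, ⊤) n N, t = ofDatum d := by
  -- In every stalk the class is represented by the datum normalised by `A * B = 1`.
  have h1 (w : W) : ∃ d : TautDatum (W.presheaf.stalk w) n N,
      TautClass.mk d = t.germ w ∧ d.A * germMatrix ⊤ B w trivial = 1 := by
    obtain ⟨d, hd, hu⟩ := h w
    obtain ⟨d', hd', hB⟩ := d.exists_equiv_mul_eq_one _ hu
    exact ⟨d', (Quotient.sound hd').symm.trans hd, hB⟩
  choose a ha haB using h1
  -- The normalised data of the stalks are locally the germs of a normalised datum of functions: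
  -- `det (A * B)` is a unit in all stalks over `U`, hence a unit on `U`, and normalised
  -- representatives are unique.
  have h2 (w : W) : ∃ (U : W.Opens) (_ : w ∈ U) (d : TautDatum Γ(W, U) n N),
      ∀ (x : W) (hx : x ∈ U), d.map (W.presheaf.germ U x hx).hom = a x := by
    obtain ⟨U, hU, d, hd⟩ := t.locally_trivial w
    obtain ⟨d', hd', hB⟩ := d.exists_equiv_mul_eq_one
      (B.map (W.presheaf.map (homOfLE le_top : U ⟶ ⊤).op).hom) (by
        rw [Matrix.isUnit_iff_isUnit_det]
        refine RingedSpace.isUnit_of_isUnit_germ _ U _ fun x hx => ?_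
        have h3 := h x
        unfold IsBasisAt at h3
        rw [hd x hx, TautClass.isBasis_mk, ← germMatrix_res B x hx, TautDatum.map_A_mul,
          Matrix.isUnit_iff_isUnit_det] at h3
        exact (congrArg IsUnit (RingHom.map_det _ _)).mpr h3)
    refine ⟨U, hU, d', fun x hx => ?_⟩
    refine TautDatum.eq_of_equiv_of_mul_eq_one (B := germMatrix ⊤ B x trivial) ?_ ?_ (haB x)
    · refine Quotient.exact (Eq.trans ?_ (ha x).symm)
      rw [hd x hx]
      exact (Quotient.sound (TautDatum.map_equiv _ hd')).symm
    · rw [← germMatrix_res B x hx, TautDatum.map_A_mul, hB]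
      exact map_one (RingHom.mapMatrix _)
  -- There is no ambiguity of basis left, so the entries of the matrix and of the section glue one
  -- by one.
  have hA (i : Fin n) (j : Fin N) := exists_germ_eq_of_locally (fun w => (a w).A i j) fun w => by
    obtain ⟨U, hU, d, hd⟩ := h2 w
    exact ⟨U, hU, d.A i j, fun x hx => congrArg (fun d => d.A i j) (hd x hx)⟩
  have hv (i : Fin n) := exists_germ_eq_of_locally (fun w => (a w).v i) fun w => by
    obtain ⟨U, hU, d, hd⟩ := h2 w
    exact ⟨U, hU, d.v i, fun x hx => congrArg (fun d => d.v i) (hd x hx)⟩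
  choose A hA using hA
  choose v hv using hv
  -- The identity may be checked on germs; it supplies the right inverse showing that the glued
  -- matrix is an epimorphism.
  have hAB : Matrix.of A * B = 1 := by
    ext i j
    apply TopCat.Presheaf.section_ext W.sheaf
    intro w hw
    have h3 : germMatrix ⊤ (Matrix.of A * B) w hw = germMatrix ⊤ 1 w hw := by
      unfold germMatrix
      rw [Matrix.map_mul]
      refine Eq.trans ?_ ((haB w).trans (map_one (RingHom.mapMatrix _)).symm)
      congr 1
      ext i j
      exact hA i j w
    exact congrFun (congrFun h3 i) j
  refine ⟨⟨Matrix.of A, v, Matrix.mulVec_surjective_iff_exists_right_inverse.mpr ⟨B, hAB⟩⟩, ?_⟩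
  apply TautMap.ext
  funext w
  rw [← ha w]
  refine congrArg TautClass.mk (TautDatum.ext ?_ ?_)
  · ext i j
    exact (hA i j w).symm
  · funext i
    exact (hv i w).symm

end TautMap

/-! ### Supports over a finite base and restriction to open neighbourhoods -/

/-- The scheme `W ×_A Z ≅ Z` is finite over `X`, so it has finitely many points when `X` has; its
image in `W` is the preimage of `Z`. -/
lemma IsEtaleNbhd.finite_preimage {W A X : Scheme.{u}} {e : W ⟶ A} {Z : Closeds A} {q : A ⟶ X}
    [Finite X] (he : IsEtaleNbhd e Z) (hf : IsFiniteOver q Z) : (e ⁻¹' (Z : Set A)).Finite := by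
  have h1 : IsFinite (redι Z ≫ q) := hf
  have h2 := he.isIso
  let f : pullback e (redι Z) ⟶ X := pullback.snd e (redι Z) ≫ redι Z ≫ q
  have h3 : (Set.univ : Set (pullback e (redι Z) : Scheme.{u})).Finite :=
    (Set.finite_univ.biUnion fun x _ => f.finite_preimage_singleton x).subset fun y _ =>
      Set.mem_biUnion (Set.mem_univ (f y)) rfl
  have h4 : Set.range (redι Z) = Z := by
    rw [Scheme.IdealSheafData.range_subschemeι]
    exact Scheme.IdealSheafData.coe_support_vanishingIdeal _
  rw [← h4, ← Scheme.Pullback.range_fst, ← Set.image_univ]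
  exact h3.image _

/-- Since `U` contains the preimage of `Z`, the open immersion `U ×_W (W ×_A Z) ⟶ W ×_A Z` is
surjective, hence an isomorphism. -/
lemma IsEtaleNbhd.comp_isOpenImmersion {U W A : Scheme.{u}} {e : W ⟶ A} {Z : Closeds A}
    (he : IsEtaleNbhd e Z) (j : U ⟶ W) [IsOpenImmersion j]
    (hj : e ⁻¹' (Z : Set A) ⊆ Set.range j) : IsEtaleNbhd (j ≫ e) Z := by
  have h1 := he.etale
  have h2 := he.isIso
  refine ⟨inferInstance, ?_⟩
  have s := (IsPullback.of_hasPullback j (pullback.fst e (redι Z))).flip.paste_horiz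
    (IsPullback.of_hasPullback e (redι Z)).flip
  have h3 : Surjective (pullback.snd j (pullback.fst e (redι Z))) := by
    rw [surjective_iff, ← Set.range_eq_univ, Scheme.Pullback.range_snd, Set.eq_univ_iff_forall]
    intro x
    refine hj ?_
    have h4 : pullback.fst e (redι Z) x ∈ Set.range (pullback.fst e (redι Z)) := ⟨x, rfl⟩
    rw [Scheme.Pullback.range_fst, Scheme.IdealSheafData.range_subschemeι] at h4
    have h5 := Scheme.IdealSheafData.coe_support_vanishingIdeal Z
    exact h5.le h4
  have h6 : IsIso (pullback.snd j (pullback.fst e (redι Z))) :=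
    (isIso_iff_isOpenImmersion_and_surjective _).mpr ⟨inferInstance, h3⟩
  rw [← s.flip.isoPullback_inv_snd]
  infer_instance

variable {k : Type u} [Field k]

/-- Open immersions into a locally Noetherian scheme are quasi-compact, so open subschemes of smooth
varieties are again of finite type over `k`. -/
instance isLocallyNoetherian_sch (X : Sm k) : IsLocallyNoetherian X.sch :=
  LocallyOfFiniteType.isLocallyNoetherian X.str

/-- An open subscheme of a smooth variety. -/
noncomputable def Sm.opens (W : Sm k) (U : W.sch.Opens) : Sm k :=
  Sm.of U.toScheme (U.ι ≫ W.str) inferInstance inferInstance inferInstance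

/-- The inclusion of an open subscheme. -/
noncomputable def Sm.opensι (W : Sm k) (U : W.sch.Opens) : W.opens U ⟶ W := Sm.homMk U.ι rfl

/-- The constant functions on a smooth variety. -/
noncomputable def Sm.const (W : Sm k) : k →+* Γ(W.sch, ⊤) :=
  W.str.appTop.hom.comp (Scheme.ΓSpecIso (CommRingCat.of k)).inv.hom

namespace Corr

variable {T : FramingTarget.{u}} {n N : ℕ} {X : Sm k} {Y : (Sm k)ᵒᵖ ⥤ Type w}

/-- The restriction of a correspondence to an open neighbourhood of the support. -/
noncomputable def restrict (c : Corr T n X Y) (U : c.W.sch.Opens)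
    (hU : Sm.mor c.e ⁻¹' (c.Z : Set (aff n X).sch) ⊆ U) : Corr T n X Y where
  Z := c.Z
  finite := c.finite
  W := c.W.opens U
  e := c.W.opensι U ≫ c.e
  nbhd := c.nbhd.comp_isOpenImmersion U.ι (by rwa [Scheme.Opens.range_ι])
  φ := T.F.map U.ι.op c.φ
  zero w := (T.isZero_map _ _ _).trans (c.zero _)
  g := Y.map (c.W.opensι U).op c.g

lemma restrict_refines (c : Corr T n X Y) (U : c.W.sch.Opens)
    (hU : Sm.mor c.e ⁻¹' (c.Z : Set (aff n X).sch) ⊆ U) : (c.restrict U hU).Refines c :=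
  ⟨rfl, c.W.opensι U, rfl, rfl, rfl⟩

end Corr

/-! ### Reduction to a trivial bundle -/

/-- Over an infinite field, a map to the tautological bundle is trivialised by a constant matrix
near a finite set of points. -/
lemma exists_isBasisAt [Infinite k] {W : Sm k} {n N : ℕ} (t : TautMap W.sch n N) {s : Set W.sch}
    (hs : s.Finite) : ∃ B : Matrix (Fin N) (Fin n) Γ(W.sch, ⊤), ∀ w ∈ s, t.IsBasisAt B w := by
  have h1 (w : W.sch) : ∃ d : TautDatum (W.sch.presheaf.stalk w) n N, TautClass.mk d = t.germ w :=
    Quotient.exists_rep _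
  choose d hd using h1
  -- The fields are the residue fields at the points of `W`, each receiving `k` through the constant
  -- functions.
  obtain ⟨B, hB⟩ := exists_forall_det_mul_map_ne_zero
    (fun w => ((IsLocalRing.residue (W.sch.presheaf.stalk w)).comp
      (W.sch.presheaf.germ ⊤ w trivial).hom).comp W.const)
    (fun w => ((d w).map (IsLocalRing.residue (W.sch.presheaf.stalk w))).A)
    (fun w => ((d w).map (IsLocalRing.residue (W.sch.presheaf.stalk w))).surj) hs.toFinset
  refine ⟨B.map W.const, fun w hw => ?_⟩
  unfold TautMap.IsBasisAt
  -- Over the local ring of `w`, a square matrix is invertible as soon as its determinant is nonzero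
  -- in the residue field.
  rw [← hd w, TautClass.isBasis_mk, Matrix.isUnit_iff_isUnit_det,
    ← isUnit_map_iff (IsLocalRing.residue (W.sch.presheaf.stalk w)), isUnit_iff_ne_zero]
  intro h
  refine hB w (hs.mem_toFinset.mpr hw) (Eq.trans ?_ h)
  refine Eq.trans (congrArg Matrix.det ?_) (RingHom.map_det _ _).symm
  exact ((d w).map_A_mul _ _)

/-- A cobordism-framed correspondence over a finite base may be refined to one where the vector
bundle is trivial. -/
lemma Corr.exists_refines_ofDatum [Infinite k] {n N : ℕ} {X : Sm k} [Finite X.sch]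
    {Y : (Sm k)ᵒᵖ ⥤ Type w} (c : Corr (tautTarget n N) n X Y) :
    ∃ (c' : Corr (tautTarget n N) n X Y) (d : TautDatum Γ(c'.W.sch, ⊤) n N),
      c'.Refines c ∧ c'.φ = TautMap.ofDatum d := by
  obtain ⟨B, hB⟩ := exists_isBasisAt (W := c.W) c.φ (c.nbhd.finite_preimage c.finite)
  let t : TautMap c.W.sch n N := c.φ
  -- By the choice of `B`, this open locus contains all points of `W` over the support.
  let U : c.W.sch.Opens := ⟨{w | t.IsBasisAt B w}, t.isOpen_isBasisAt B⟩
  obtain ⟨d, hd⟩ := (t.pull U.ι).exists_eq_ofDatum (B.map U.ι.appTop.hom)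
    fun w => TautMap.IsBasisAt.pull U.ι (t := t) w.2
  exact ⟨c.restrict U hB, d, c.restrict_refines U hB, hd⟩

/-! ### Framings with an auxiliary matrix, and linear homotopies -/

lemma TautMap.map_ofDatum {n N : ℕ} {W W' : Scheme.{u}} (f : W' ⟶ W)
    (d : TautDatum Γ(W, ⊤) n N) :
    (tautTarget n N).F.map f.op (TautMap.ofDatum d) = TautMap.ofDatum (d.map f.appTop.hom) := by
  apply TautMap.ext
  funext w
  change TautClass.mk (d.map ((W.presheaf.germ ⊤ (f w) trivial) ≫ f.stalkMap w).hom) =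
    TautClass.mk (d.map (f.appTop ≫ W'.presheaf.germ ⊤ w trivial).hom)
  exact congrArg (fun a => TautClass.mk (d.map (CommRingCat.Hom.hom a)))
    (Scheme.Hom.germ_stalkMap f ⊤ w trivial)

namespace Corr

variable {n N : ℕ} {X X' : Sm k} {Y : (Sm k)ᵒᵖ ⥤ Type w}

/-- The cobordism-framed correspondence given by a framed correspondence and a right invertible
matrix, that is, an epimorphism to the trivial bundle. -/
noncomputable def withMatrix (c : Corr (affTarget n) n X Y)
    (A : Matrix (Fin n) (Fin N) Γ(c.W.sch, ⊤)) (hA : Function.Surjective A.mulVec) :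
    Corr (tautTarget n N) n X Y where
  Z := c.Z
  finite := c.finite
  W := c.W
  e := c.e
  nbhd := c.nbhd
  φ := TautMap.ofDatum ⟨A, c.φ, hA⟩
  zero w := Iff.trans (forall_congr' fun i => (notMem_basicOpen_iff (c.φ i) w).symm) (c.zero w)
  g := c.g

/-- The zero locus of `(A, v)` is that of `v`, so forgetting `A` leaves a framed correspondence with
the same support and the same étale neighbourhood. -/
lemma exists_withMatrix_eq (c : Corr (tautTarget n N) n X Y) (d : TautDatum Γ(c.W.sch, ⊤) n N)
    (hd : c.φ = TautMap.ofDatum d) :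
    ∃ (c₀ : Corr (affTarget n) n X Y) (A : Matrix (Fin n) (Fin N) Γ(c₀.W.sch, ⊤))
      (hA : Function.Surjective A.mulVec), c = c₀.withMatrix A hA := by
  obtain ⟨Z, finite, W, e, nbhd, φ, zero, g⟩ := c
  change TautDatum Γ(W.sch, ⊤) n N at d
  obtain rfl : φ = TautMap.ofDatum d := hd
  refine ⟨⟨Z, finite, W, e, nbhd, d.v, fun w => ?_, g⟩, d.A, d.surj, rfl⟩
  exact Iff.trans (forall_congr' fun i => notMem_basicOpen_iff (d.v i) w) (zero w)

/-- This recognises the end of the homotopies as an element of the image of the comparison map. -/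
lemma withMatrix_proj (c : Corr (affTarget n) n X Y) (N : ℕ) :
    c.withMatrix (TautDatum.proj (Nat.le_add_right n N) c.φ).A (TautDatum.proj _ c.φ).surj =
      c.cob N := rfl

lemma withMatrix_baseChange (c : Corr (affTarget n) n X Y)
    (A : Matrix (Fin n) (Fin N) Γ(c.W.sch, ⊤)) (hA : Function.Surjective A.mulVec)
    (f : X' ⟶ X) (hA' : Function.Surjective (A.map (Sm.res (c.bcFst f))).mulVec) :
    (c.withMatrix A hA).baseChange f =
      (c.baseChange f).withMatrix (A.map (Sm.res (c.bcFst f))) hA' := by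
  simp only [withMatrix, baseChange]
  congr 1
  exact TautMap.map_ofDatum _ _

/-- The matrix `A'` is a variable subject to the equation `h`, so that it can be a matrix that
agrees with the pullback of `A` only after a computation. -/
lemma withMatrix_refines {c' c : Corr (affTarget n) n X Y} (hZ : c'.Z = c.Z) (i : c'.W ⟶ c.W)
    (he : i ≫ c.e = c'.e) (hφ : (affTarget n).F.map (Sm.mor i).op c.φ = c'.φ)
    (hg : Y.map i.op c.g = c'.g) (A : Matrix (Fin n) (Fin N) Γ(c.W.sch, ⊤))
    (hA : Function.Surjective A.mulVec) {A' : Matrix (Fin n) (Fin N) Γ(c'.W.sch, ⊤)}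
    (hA' : Function.Surjective A'.mulVec) (h : A.map (Sm.res i) = A') :
    (c'.withMatrix A' hA').Refines (c.withMatrix A hA) := by
  subst h
  refine ⟨hZ, i, he, (TautMap.map_ofDatum _ _).trans (congrArg TautMap.ofDatum ?_), hg⟩
  exact TautDatum.ext rfl hφ

lemma surjective_mulVec_map {R S : Type*} [CommRing R] [CommRing S] (f : R →+* S)
    {A : Matrix (Fin n) (Fin N) R} (hA : Function.Surjective A.mulVec) :
    Function.Surjective (A.map f).mulVec := by
  obtain ⟨B, hB⟩ := Matrix.mulVec_surjective_iff_exists_right_inverse.mp hA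
  refine Matrix.mulVec_surjective_iff_exists_right_inverse.mpr ⟨B.map f, ?_⟩
  rw [← Matrix.map_mul, hB, Matrix.map_one f (map_zero f) (map_one f)]

/-- Two epimorphisms to a trivial bundle with a common right inverse are joined by a linear
homotopy. -/
lemma exists_linear_homotopy (c : Corr (affTarget n) n X Y) {P : Sm k} (σ : P ⟶ X)
    (t : Γ(P.sch, ⊤)) {A₀ A₁ : Matrix (Fin n) (Fin N) Γ(c.W.sch, ⊤)}
    {B : Matrix (Fin N) (Fin n) Γ(c.W.sch, ⊤)} (h₀ : A₀ * B = 1) (h₁ : A₁ * B = 1) :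
    ∃ h : Corr (tautTarget n N) n P Y, ∀ (δ : X ⟶ P) (_ : δ ≫ σ = 𝟙 X)
      (A : Matrix (Fin n) (Fin N) Γ(c.W.sch, ⊤)) (hA : Function.Surjective A.mulVec),
      (Sm.res δ t = 0 ∧ A = A₀) ∨ (Sm.res δ t = 1 ∧ A = A₁) →
      (h.baseChange δ).Refines (c.withMatrix A hA) := by
  let ρ := Sm.res (c.bcFst σ)
  -- The homotopy parameter `t`, viewed as a function on the étale neighbourhood over `P`.
  let τ : Γ((c.baseChange σ).W.sch, ⊤) := Sm.res ((c.baseChange σ).e ≫ affProj n P) t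
  let A' : Matrix (Fin n) (Fin N) Γ((c.baseChange σ).W.sch, ⊤) :=
    A₀.map ρ + τ • (A₁ - A₀).map ρ
  -- The direction `A₁ - A₀` is killed by `B`, so `B` remains a right inverse along the whole line.
  have hA' : A' * B.map ρ = 1 := by
    rw [Matrix.add_mul, Matrix.smul_mul, ← Matrix.map_mul, ← Matrix.map_mul, Matrix.sub_mul, h₀, h₁,
      sub_self, Matrix.map_zero _ (map_zero ρ), smul_zero, add_zero,
      Matrix.map_one _ (map_zero ρ) (map_one ρ)]
  have hs := Matrix.mulVec_surjective_iff_exists_right_inverse.mpr ⟨_, hA'⟩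
  refine ⟨(c.baseChange σ).withMatrix A' hs, fun δ hδ A hA h => ?_⟩
  rw [withMatrix_baseChange _ _ _ _ (surjective_mulVec_map _ hs)]
  -- As `δ ≫ σ` is the identity, pulling back along `σ` and then along `δ` only refines `c`; the
  -- refining map is the composite of the two projections.
  refine withMatrix_refines (c' := (c.baseChange σ).baseChange δ) (c := c) ?_
    ((c.baseChange σ).bcFst δ ≫ c.bcFst σ) ?_ ?_ ?_ A hA _ ?_
  · ext p
    change p ∈ ((c.baseChange σ).baseChange δ).Z ↔ p ∈ c.Z
    rw [mem_bc_Z, mem_bc_Z, ← Scheme.Hom.comp_apply, ← Sm.mor_comp, ← affMap_comp, hδ, affMap_id]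
    rfl
  · rw [Category.assoc, bc_condition, ← Category.assoc, bc_condition, Category.assoc,
      ← affMap_comp, hδ, affMap_id, Category.comp_id]
  · exact F_map_comp _ _ _ _
  · exact Y_map_comp _ _ _ _
  · have hτ : Sm.res ((c.baseChange σ).bcFst δ) τ =
        Sm.res (((c.baseChange σ).baseChange δ).e ≫ affProj n X) (Sm.res δ t) := by
      rw [← Sm.res_comp, ← Sm.res_comp, ← Category.assoc, bc_condition, Category.assoc, affMap_proj,
        Category.assoc]
    ext i j
    change Sm.res ((c.baseChange σ).bcFst δ) (Sm.res (c.bcFst σ) (A i j)) =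
      Sm.res ((c.baseChange σ).bcFst δ) (Sm.res (c.bcFst σ) (A₀ i j) +
        τ * Sm.res (c.bcFst σ) (A₁ i j - A₀ i j))
    rw [map_add, map_mul, hτ]
    rcases h with ⟨h, rfl⟩ | ⟨h, rfl⟩ <;> rw [h]
    · rw [map_zero, zero_mul, add_zero]
    · rw [map_one, one_mul, ← map_add, ← map_add, add_sub_cancel]

end Corr

/-! ### Block matrices with a common right inverse -/

/-- The extension of a matrix by columns of zeros. -/
def padMatrix {R : Type*} [Zero R] {n m : ℕ} (m' : ℕ) (A : Matrix (Fin n) (Fin m) R) :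
    Matrix (Fin n) (Fin m') R :=
  Matrix.of fun i j => if h : (j : ℕ) < m then A i ⟨j, h⟩ else 0

/-- The matrix with columns the standard basis, starting from the column `m`, and zero
elsewhere. -/
def unitMatrix (R : Type*) [Zero R] [One R] (n m m' : ℕ) : Matrix (Fin n) (Fin m') R :=
  Matrix.of fun i j => if (j : ℕ) = m + i then 1 else 0

section Matrix

variable {R : Type*} [CommRing R] {n m m' : ℕ}

/-- The matrix with the rows of `B` followed by the standard basis. -/
def stackMatrix (m' : ℕ) (B : Matrix (Fin m) (Fin n) R) : Matrix (Fin m') (Fin n) R :=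
  Matrix.of fun j i => if h : (j : ℕ) < m then B ⟨j, h⟩ i else if (j : ℕ) = m + i then 1 else 0

/-- The added columns are zero, so only the upper block `B` of the stacked matrix contributes. -/
lemma padMatrix_mul_stackMatrix (h : m ≤ m') (A : Matrix (Fin n) (Fin m) R)
    (B : Matrix (Fin m) (Fin n) R) : padMatrix m' A * stackMatrix m' B = A * B := by
  obtain ⟨l, rfl⟩ := Nat.exists_eq_add_of_le h
  ext i i'
  simp [Matrix.mul_apply, padMatrix, stackMatrix, Fin.sum_univ_add]

/-- The rows `m, …, m + n - 1` of the stacked matrix form the identity block, which fits because `m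
+ n ≤ m'`. Hence, when `A * B = 1`, the matrices `(A | 0)` and `(0 | 1)` have a common right
inverse. -/
lemma unitMatrix_mul_stackMatrix (h : m + n ≤ m') (B : Matrix (Fin m) (Fin n) R) :
    unitMatrix R n m m' * stackMatrix m' B = 1 := by
  ext i i'
  rw [Matrix.mul_apply, Finset.sum_eq_single (⟨m + i, by omega⟩ : Fin m')]
  · simp [unitMatrix, stackMatrix, Matrix.one_apply, Fin.ext_iff]
  · intro j _ hj
    have : ¬ (j : ℕ) = m + i := fun e => hj (Fin.ext e)
    simp [unitMatrix, this]
  · simp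

end Matrix

/-! ### Framed representatives up to a boundary -/

section Homotopy

variable {n N : ℕ} {X P : Sm k} {Y : (Sm k)ᵒᵖ ⥤ Type w}

lemma TautMap.inc_ofDatum {W : Scheme.{u}} (d : TautDatum Γ(W, ⊤) n N) :
    TautMap.inc (TautMap.ofDatum d) = TautMap.ofDatum d.inc := by
  apply TautMap.ext
  funext w
  exact congrArg TautClass.mk (TautDatum.map_inc _ d).symm

namespace ZF

/-- The matrix occurs in the type of the surjectivity proof, so an equality of matrices cannot
simply be rewritten. -/
lemma mk_withMatrix_congr (c : Corr (affTarget n) n X Y)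
    {A A' : Matrix (Fin n) (Fin (n + N)) Γ(c.W.sch, ⊤)} (h : A = A')
    (hA : Function.Surjective A.mulVec) (hA' : Function.Surjective A'.mulVec) :
    mk cobFramed (n := n) (j := N) (c.withMatrix A hA) =
      mk cobFramed (n := n) (j := N) (c.withMatrix A' hA') := by
  subst h
  rfl

/-- For a trivial bundle the stabilisation in `N` adds a zero column. Only the matrix of `d`
matters, the section being `c.φ`. -/
lemma mk_withMatrix_inc (c : Corr (affTarget n) n X Y)
    (d : TautDatum Γ(c.W.sch, ⊤) n (n + N)) :
    mk cobFramed (n := n) (j := N + 1) (c.withMatrix d.inc.A d.inc.surj) =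
      mk cobFramed (n := n) (j := N) (c.withMatrix d.A d.surj) := by
  refine Eq.trans ?_ (mk_inc (S := cobFramed) (n := n) (j := N) (c.withMatrix d.A d.surj))
  refine congrArg (mk cobFramed (n := n) (j := N + 1)) ?_
  simp only [Corr.withMatrix, Corr.mapTarget]
  congr 1
  exact (TautMap.inc_ofDatum (N := n + N) ⟨d.A, c.φ, d.surj⟩).symm

/-- Adding `K` zero columns is the `K`-fold stabilisation in `N`, which does not change the stable
class. -/
lemma mk_withMatrix_pad (c : Corr (affTarget n) n X Y)
    (A : Matrix (Fin n) (Fin (n + N)) Γ(c.W.sch, ⊤)) (hA : Function.Surjective A.mulVec) (K : ℕ)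
    (hA' : Function.Surjective (padMatrix (n + (N + K)) A).mulVec) :
    mk cobFramed (n := n) (j := N + K) (c.withMatrix _ hA') =
      mk cobFramed (n := n) (j := N) (c.withMatrix A hA) := by
  induction K with
  | zero =>
    refine mk_withMatrix_congr (N := N) c ?_ _ _
    ext i j
    exact dif_pos j.2
  | succ K ih =>
    -- The intermediate padded matrices are epimorphisms too, with a right inverse made from one of
    -- `A`.
    have hs : Function.Surjective (padMatrix (n + (N + K)) A).mulVec := by
      obtain ⟨B, hB⟩ := Matrix.mulVec_surjective_iff_exists_right_inverse.mp hA
      exact Matrix.mulVec_surjective_iff_exists_right_inverse.mpr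
        ⟨_, (padMatrix_mul_stackMatrix (by omega) A B).trans hB⟩
    rw [← ih hs]
    refine Eq.trans ?_ (mk_withMatrix_inc (N := N + K) c ⟨_, c.φ, hs⟩)
    refine mk_withMatrix_congr (N := N + K + 1) c ?_ _ _
    ext i j
    refine Fin.lastCases ?_ (fun j => ?_) j
    · have h : ¬ n + (N + K) < n + N := by omega
      simp [TautDatum.inc, padMatrix]
    · simp [TautDatum.inc, padMatrix]

variable (δ₀ δ₁ : X ⟶ P)

/-- The classes of two epimorphisms to a trivial bundle with a common right inverse differ by a
boundary. -/
lemma mk_withMatrix_sub_mem (σ : P ⟶ X) (t : Γ(P.sch, ⊤)) (h₀ : δ₀ ≫ σ = 𝟙 X)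
    (h₁ : δ₁ ≫ σ = 𝟙 X) (t₀ : Sm.res δ₀ t = 0) (t₁ : Sm.res δ₁ t = 1)
    (c : Corr (affTarget n) n X Y) {A₀ A₁ : Matrix (Fin n) (Fin (n + N)) Γ(c.W.sch, ⊤)}
    (hA₀ : Function.Surjective A₀.mulVec) (hA₁ : Function.Surjective A₁.mulVec)
    {B : Matrix (Fin (n + N)) (Fin n) Γ(c.W.sch, ⊤)} (hB₀ : A₀ * B = 1) (hB₁ : A₁ * B = 1) :
    mk cobFramed (n := n) (j := N) (c.withMatrix A₀ hA₀) -
      mk cobFramed (n := n) (j := N) (c.withMatrix A₁ hA₁) ∈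
      (baseChange cobFramed Y δ₀ - baseChange cobFramed Y δ₁).range := by
  obtain ⟨h, hh⟩ := c.exists_linear_homotopy σ t hB₀ hB₁
  refine ⟨mk cobFramed (n := n) (j := N) h, ?_⟩
  rw [AddMonoidHom.sub_apply]
  exact congrArg₂ _
    (mk_refines (S := cobFramed) (j := N) (hh δ₀ h₀ A₀ hA₀ (Or.inl ⟨t₀, rfl⟩)))
    (mk_refines (S := cobFramed) (j := N) (hh δ₁ h₁ A₁ hA₁ (Or.inr ⟨t₁, rfl⟩)))

/-- Over a finite base, every cobordism-framed correspondence is framed up to homotopy. -/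
lemma cob_range_sup_eq_top [Infinite k] [Finite X.sch] (σ : P ⟶ X) (t : Γ(P.sch, ⊤))
    (h₀ : δ₀ ≫ σ = 𝟙 X) (h₁ : δ₁ ≫ σ = 𝟙 X) (t₀ : Sm.res δ₀ t = 0) (t₁ : Sm.res δ₁ t = 1) :
    (cob X Y).range ⊔ (baseChange cobFramed Y δ₀ - baseChange cobFramed Y δ₁).range = ⊤ := by
  set H := (cob X Y).range ⊔ (baseChange cobFramed Y δ₀ - baseChange cobFramed Y δ₁).range with hH
  -- It is enough that the quotient map by `H` vanishes, which can be tested on classes of explicit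
  -- correspondences.
  suffices h : QuotientAddGroup.mk' H = 0 by
    rw [← QuotientAddGroup.ker_mk' H, h, AddMonoidHom.ker_zero]
  refine hom_ext fun n (N : ℕ) c => ?_
  refine (QuotientAddGroup.eq_zero_iff _).mpr ?_
  obtain ⟨c', d, hc, hd⟩ := Corr.exists_refines_ofDatum (n := n) (N := n + N) c
  rw [← mk_refines (S := cobFramed) (n := n) (j := N) hc]
  obtain ⟨c₀, A, hA, rfl⟩ := c'.exists_withMatrix_eq d hd
  obtain ⟨B, hB⟩ := Matrix.mulVec_surjective_iff_exists_right_inverse.mp hA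
  obtain ⟨C, hC⟩ := Matrix.mulVec_surjective_iff_exists_right_inverse.mp
    (TautDatum.proj (Nat.le_add_right n N) c₀.φ).surj
  -- Replacing `N` by `N + n` makes room for an identity block beside the original `n + N` columns.
  -- The matrix `(0 | 1)` is compared with `(A | 0)` through the right inverse made from `B`, and
  -- with the padded projection through the one made from `C`.
  have e₁ := (padMatrix_mul_stackMatrix (m' := n + (N + n)) (by omega) A B).trans hB
  have e₂ := unitMatrix_mul_stackMatrix (m' := n + (N + n)) (by omega) B
  have e₃ := unitMatrix_mul_stackMatrix (m' := n + (N + n)) (by omega) C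
  have e₄ := (padMatrix_mul_stackMatrix (m' := n + (N + n)) (by omega) _ C).trans hC
  have s₁ := Matrix.mulVec_surjective_iff_exists_right_inverse.mpr ⟨_, e₁⟩
  have s₂ := Matrix.mulVec_surjective_iff_exists_right_inverse.mpr ⟨_, e₂⟩
  have s₄ := Matrix.mulVec_surjective_iff_exists_right_inverse.mpr ⟨_, e₄⟩
  have m₁ := mk_withMatrix_sub_mem (N := N + n) δ₀ δ₁ σ t h₀ h₁ t₀ t₁ c₀ s₁ s₂ e₁ e₂
  have m₂ := mk_withMatrix_sub_mem (N := N + n) δ₀ δ₁ σ t h₀ h₁ t₀ t₁ c₀ s₂ s₄ e₃ e₄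
  rw [mk_withMatrix_pad c₀ A hA n s₁] at m₁
  -- The padded projection has the class of the projection itself, which is the image of the framed
  -- correspondence `c₀`.
  rw [mk_withMatrix_pad c₀ _ (TautDatum.proj (Nat.le_add_right n N) c₀.φ).surj n s₄,
    Corr.withMatrix_proj, ← cob_mk] at m₂
  -- The class of `(0 | 1)` cancels.
  have m₃ := add_mem m₁ m₂
  rw [sub_add_sub_cancel] at m₃
  have m₄ := add_mem (hH ▸ AddSubgroup.mem_sup_right m₃ : _ ∈ H)
    (hH ▸ AddSubgroup.mem_sup_left ⟨_, rfl⟩ : cob X Y (mk framed (n := n) (j := ()) c₀) ∈ H)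
  rwa [sub_add_cancel] at m₄

end ZF

end Homotopy

/-! ### The face maps of the simplices -/

/-- The only barycentric coordinate of `Δ⁰` equals `1`, so constants generate. It follows that `Δ⁰`
has no more points than `Spec k`. -/
lemma SimplexRing.algebraMap_surjective (k : Type u) [Field k] :
    Function.Surjective (algebraMap k (SimplexRing k 0)) := by
  intro a
  have h : (Algebra.ofId k (SimplexRing k 0)).comp (lift (fun _ => 1) (by simp)) =
      AlgHom.id k _ := by
    apply hom_ext
    intro i
    obtain rfl : i = 0 := Subsingleton.elim (α := Fin 1) i 0
    rw [AlgHom.comp_apply, lift_bary, map_one, AlgHom.id_apply, ← sum_bary k 0]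
    exact Fin.sum_univ_one _
  exact ⟨_, congrArg (fun f => f a) h⟩

/-- The projection `T × X ⟶ T`. -/
noncomputable def Sm.prodFst (T X : Sm k) : Sm.prod T X ⟶ T :=
  Sm.homMk (pullback.fst T.str X.str) rfl

lemma Sm.prodRight_map_fst (X : Sm k) {T T' : Sm k} (f : T ⟶ T') :
    (Sm.prodRight X).map f ≫ Sm.prodFst T' X = Sm.prodFst T X ≫ f :=
  Sm.hom_ext (pullback.lift_fst _ _ _)

/-- The barycentric coordinates as functions. -/
noncomputable def simplexCoord (k : Type u) [Field k] (n : ℕ) (i : Fin (n + 1)) :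
    Γ((simplex k n).sch, ⊤) :=
  (Scheme.ΓSpecIso (CommRingCat.of (SimplexRing k n))).inv.hom (SimplexRing.bary k i)

lemma res_simplexCoord {m n : SimplexCategory} (θ : m ⟶ n) (i : Fin (n.len + 1)) :
    Sm.res ((simplexFunctor k).map θ) (simplexCoord k n.len i) =
      (Scheme.ΓSpecIso (CommRingCat.of (SimplexRing k m.len))).inv.hom
        (∑ j with θ.toOrderHom j = i, SimplexRing.bary k j) := by
  rw [← SimplexRing.map_bary]
  exact congrArg (fun f => f.hom (SimplexRing.bary k i)) (Scheme.ΓSpecIso_inv_naturality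
    (CommRingCat.ofHom (SimplexRing.map (k := k) θ.toOrderHom).toRingHom)).symm

/-- The variety `Δⁿ × X`. -/
noncomputable abbrev simplexProd (X : Sm k) (n : ℕ) : Sm k :=
  (simplexFunctor k ⋙ Sm.prodRight X).obj (SimplexCategory.mk n)

/-- The face maps `Δⁿ × X ⟶ Δⁿ⁺¹ × X`. -/
noncomputable abbrev simplexFace (X : Sm k) {n : ℕ} (i : Fin (n + 2)) :
    simplexProd X n ⟶ simplexProd X (n + 1) :=
  (simplexFunctor k ⋙ Sm.prodRight X).map (SimplexCategory.δ i)

/-- The degeneracy `Δ¹ × X ⟶ Δ⁰ × X`. -/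
noncomputable abbrev simplexDegeneracy (X : Sm k) : simplexProd X 1 ⟶ simplexProd X 0 :=
  (simplexFunctor k ⋙ Sm.prodRight X).map (SimplexCategory.σ 0)

/-- Already in the simplex category the composite is an endomorphism of `[0]`, hence the identity.
-/
lemma simplexFace_degeneracy (X : Sm k) (i : Fin 2) :
    simplexFace X i ≫ simplexDegeneracy X = 𝟙 (simplexProd X 0) := by
  rw [← Functor.map_comp]
  refine (congrArg _ ?_).trans (CategoryTheory.Functor.map_id _ _)
  ext j
  exact congrArg Fin.val (Subsingleton.elim (α := Fin 1) _ _)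

/-- The parameter of the homotopies: the barycentric coordinate on `Δ¹ × X` which is zero on the
face `0` and one on the face `1`. -/
noncomputable def simplexParam (X : Sm k) : Γ((simplexProd X 1).sch, ⊤) :=
  Sm.res (Sm.prodFst (simplex k 1) X) (simplexCoord k 1 0)

lemma res_simplexParam (X : Sm k) (i : Fin 2) :
    Sm.res (simplexFace X i) (simplexParam X) =
      Sm.res (Sm.prodFst (simplex k 0) X)
        ((Scheme.ΓSpecIso (CommRingCat.of (SimplexRing k 0))).inv.hom
          (∑ j with (SimplexCategory.δ (n := 0) i).toOrderHom j = 0, SimplexRing.bary k j)) :=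
  (congrArg (fun f => Sm.res f (simplexCoord k 1 0))
    (Sm.prodRight_map_fst X ((simplexFunctor k).map (SimplexCategory.δ (n := 0) i)))).trans
    (congrArg (Sm.res (Sm.prodFst (simplex k 0) X))
      (res_simplexCoord (k := k) (SimplexCategory.δ (n := 0) i) (0 : Fin 2)))

lemma res_simplexParam_zero (X : Sm k) : Sm.res (simplexFace X 0) (simplexParam X) = 0 := by
  rw [res_simplexParam, Finset.filter_false_of_mem, Finset.sum_empty, map_zero]
  · exact map_zero _
  intro j _
  -- The face `0` is the vertex `1`, so no vertex maps to `0` and the sum is empty.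
  exact Fin.succ_ne_zero (n := 1) j

lemma res_simplexParam_one (X : Sm k) : Sm.res (simplexFace X 1) (simplexParam X) = 1 := by
  rw [res_simplexParam, Finset.filter_true_of_mem]
  -- The face `1` is the vertex `0`, so the sum runs over all barycentric coordinates of `Δ⁰` and
  -- equals `1`.
  · exact (congrArg _ ((congrArg _ (SimplexRing.sum_bary k 0)).trans (map_one _))).trans (map_one _)
  · intro j _
    obtain rfl : j = 0 := Subsingleton.elim (α := Fin 1) j 0
    rfl

/-- The projection `Δ⁰ × pt ⟶ Δ⁰` is an isomorphism, and `Δ⁰` injects into `Spec k`. This is the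
finiteness of the base that makes the supports finite sets. -/
instance finite_simplexProd_pt : Finite (simplexProd (Sm.pt k) 0).sch := by
  have h : Finite (simplex k 0).sch := by
    refine Finite.of_injective (β := PrimeSpectrum k)
      (PrimeSpectrum.comap (algebraMap k (SimplexRing k 0))) ?_
    exact PrimeSpectrum.comap_injective_of_surjective _ (SimplexRing.algebraMap_surjective k)
  have h1 : IsIso (pullback.fst (simplex k 0).str (Sm.pt k).str) := by
    have : IsIso (Sm.pt k).str := by change IsIso (𝟙 _); infer_instance
    infer_instance
  exact Finite.of_injective _ (pullback.fst (simplex k 0).str (Sm.pt k).str).injective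

/-! ### Homology in degree zero -/

/-- A surjectivity criterion on `H⁰`. -/
lemma H0Map_surjective {F G : (Sm k)ᵒᵖ ⥤ AddCommGrpCat.{w}} (η : F ⟶ G) (X : Sm k)
    (h : ∀ y : G.obj (op (simplexProd X 0)), ∃ (x : F.obj (op (simplexProd X 0)))
      (b : G.obj (op (simplexProd X 1))), y = η.app _ x +
        (G.map (simplexFace X 0).op b - G.map (simplexFace X 1).op b)) :
    Function.Surjective (H0Map η X) := by
  have hd (b : (cStar G X).X 1) : (cStar G X).d 1 0 b =
      G.map (simplexFace X 0).op b - G.map (simplexFace X 1).op b := by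
    -- In degree one the alternating sum has two terms, with signs `+` and `-`.
    have h1 : (cStar G X).d 1 0 = G.map (simplexFace X 0).op - G.map (simplexFace X 1).op := by
      refine (AlgebraicTopology.alternatingFaceMapComplex_obj_d _ 0).trans ?_
      rw [AlgebraicTopology.AlternatingFaceMapComplex.objD, Fin.sum_univ_two]
      simp only [Fin.val_zero, pow_zero, one_smul, Fin.val_one, pow_one, neg_smul,
        ← sub_eq_add_neg]
      rfl
    rw [h1]
    rfl
  -- Every `0`-chain is a cycle: no degree follows `0`, the default successor is `0` itself, and the
  -- map `d 0 0` is zero.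
  have hi (K : ChainComplex AddCommGrpCat.{w} ℕ) : IsIso (K.iCycles 0) :=
    K.isIso_iCycles 0 0 (by simp) (K.shape _ _ (by simp))
  intro z
  obtain ⟨c, rfl⟩ := (AddCommGrpCat.epi_iff_surjective ((cStar G X).homologyπ 0)).mp inferInstance z
  obtain ⟨x, b, hxb⟩ := h ((cStar G X).iCycles 0 c)
  have hF := hi (cStar F X)
  have hG := hi (cStar G X)
  obtain ⟨x', hx'⟩ := (ConcreteCategory.bijective_of_isIso ((cStar F X).iCycles 0)).2 x
  refine ⟨(cStar F X).homologyπ 0 x', ?_⟩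
  -- The inclusion of cycles is injective, so the decomposition of the chain `c` lifts to cycles;
  -- the boundary of `b` then dies in homology.
  have h1 : HomologicalComplex.cyclesMap (cStarMap η X) 0 x' = c - (cStar G X).toCycles 1 0 b := by
    refine (ConcreteCategory.bijective_of_isIso ((cStar G X).iCycles 0)).1 ?_
    rw [map_sub]
    have h2 : (cStar G X).iCycles 0 (HomologicalComplex.cyclesMap (cStarMap η X) 0 x') =
        (cStarMap η X).f 0 ((cStar F X).iCycles 0 x') :=
      ConcreteCategory.congr_hom (HomologicalComplex.cyclesMap_i (cStarMap η X) 0) x'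
    have h3 : (cStar G X).iCycles 0 ((cStar G X).toCycles 1 0 b) = (cStar G X).d 1 0 b :=
      ConcreteCategory.congr_hom ((cStar G X).toCycles_i 1 0) b
    rw [h2, h3, hx']
    refine Eq.trans ?_ (congrArg (_ - ·) (hd b)).symm
    exact (add_sub_cancel_right _ _).symm.trans (congrArg (· - _) hxb.symm)
  have h2 : H0Map η X ((cStar F X).homologyπ 0 x') =
      (cStar G X).homologyπ 0 (HomologicalComplex.cyclesMap (cStarMap η X) 0 x') :=
    ConcreteCategory.congr_hom (HomologicalComplex.homologyπ_naturality (cStarMap η X) 0) x'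
  have h3 : (cStar G X).homologyπ 0 ((cStar G X).toCycles 1 0 b) = 0 :=
    ConcreteCategory.congr_hom ((cStar G X).toCycles_comp_homologyπ 1 0) b
  rw [h2, h1, map_sub, h3, sub_zero]

/-- Every stable linear cobordism-framed correspondence over the point is framed up to a
boundary. -/
lemma exists_eq_zfCob_add_boundary [Infinite k] (Y : (Sm k)ᵒᵖ ⥤ Type w)
    (y : (zf cobFramed Y).obj (op (simplexProd (Sm.pt k) 0))) :
    ∃ (x : (zf framed Y).obj (op (simplexProd (Sm.pt k) 0)))
      (b : (zf cobFramed Y).obj (op (simplexProd (Sm.pt k) 1))), y = (zfCob Y).app _ x +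
        ((zf cobFramed Y).map (simplexFace (Sm.pt k) 0).op b -
          (zf cobFramed Y).map (simplexFace (Sm.pt k) 1).op b) := by
  have h := ZF.cob_range_sup_eq_top (Y := Y) (simplexFace (Sm.pt k) 0) (simplexFace (Sm.pt k) 1)
    (simplexDegeneracy (Sm.pt k)) (simplexParam (Sm.pt k)) (simplexFace_degeneracy _ 0)
    (simplexFace_degeneracy _ 1) (res_simplexParam_zero _) (res_simplexParam_one _)
  obtain ⟨_, ⟨x, rfl⟩, _, ⟨b, rfl⟩, e⟩ := AddSubgroup.mem_sup.mp
    (h.ge (AddSubgroup.mem_top (y : ZF cobFramed (simplexProd (Sm.pt k) 0) Y)))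
  exact ⟨x, b, e.symm⟩

lemma HcobTilde_pt_surjective [Infinite k] (Y : (Sm k)ᵒᵖ ⥤ Type w) :
    Function.Surjective (HcobTilde (Sm.pt k) Y) :=
  H0Map_surjective _ _ (exists_eq_zfCob_add_boundary Y)

/-- An element of the summand is `p y` for the endomorphism `p` defining it. Applying `p` to a
decomposition of `y` into a framed part and a boundary gives one inside the summands. -/
lemma Hcob_pt_surjective [Infinite k] (m : ℕ) : Function.Surjective (Hcob (Sm.pt k) m) := by
  refine H0Map_surjective _ _ ?_
  rintro ⟨_, y, rfl⟩
  obtain ⟨x, b, e⟩ := exists_eq_zfCob_add_boundary (gmPow k m) y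
  refine ⟨⟨_, x, rfl⟩, ⟨_, b, rfl⟩, Subtype.ext ?_⟩
  -- The endomorphism commutes with the two face maps by naturality, and with the comparison map by
  -- `smashIdem_cob`.
  have h (i : Fin 2) := NatTrans.naturality_apply (smashIdem k cobFramed m)
    (simplexFace (Sm.pt k) i).op b
  have h' := congrArg (fun f => f.app (op (simplexProd (Sm.pt k) 0)) x) (smashIdem_cob k m)
  refine (congrArg ((smashIdem k cobFramed m).app (op (simplexProd (Sm.pt k) 0))) e).trans ?_
  rw [map_add, map_sub]
  exact congrArg₂ _ h'.symm (congrArg₂ _ (h 0) (h 1))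

end CobFr

theorem mainTheorem5 (k : Type u) [Field k] [CharZero k] :
    (∀ Y : CategoryTheory.Functor (Opposite (CobFr.Sm k)) (Type w),
      Function.Surjective (CobFr.HcobTilde (CobFr.Sm.pt k) Y)) ∧
    ∀ m : ℕ, Function.Surjective (CobFr.Hcob (CobFr.Sm.pt k) m) := by
  -- Characteristic zero enters only through the infinitude of `k`, needed for matrices in general
  -- position.
  have : Infinite k := Infinite.of_injective ((↑) : ℕ → k) Nat.cast_injective
  exact ⟨CobFr.HcobTilde_pt_surjective, CobFr.Hcob_pt_surjective⟩
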